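/- Let $U\subset\mathbb C$ be an open neighbourhood of $0$, let $k:U\to\mathbb R$ be real analytic and positive, and let $\mu(z)=k(z)|z|^2$ on $U$. For $\epsilon>0$ let $E_\epsilon$ be the connected component containing $0$ of $\{z\in U:\mu(z)<\epsilon^2\}$. Call $(R_1,R_2,h)$ a Riemann mapping family for $\mu$ if $R_1,R_2>0$, $h(\epsilon,z)$ is a holomorphic function of two complex variables on $|\epsilon|<R_1$, $|z|<R_2$, and for every real $\epsilon$ with $0<\epsilon<R_1$ one has $E_\epsilon\subset\{|z|<R_2\}$ and $z\mapsto h(\epsilon,z)$ maps $E_\epsilon$ bijectively onto the disk $|w|<\epsilon$, with $h(\epsilon,0)=0$ and $\partial_z h(\epsilon,0)>0$ (i.e. $h(\epsilon,\cdot)$ is the normalized Riemann mapping of $E_\epsilon$ onto the disk of radius $\epsilon$). Then a Riemann mapping family for $\mu$ exists, and it can be chosen with $h(-\epsilon,z)=h(\epsilon,z)$. Moreover, $\mu$ has a Taylor expansion $$\mu(z)=\sum_{r,s\ge 0}c_{r,s}\,z^{r+1}\bar z^{\,s+1},\qquad c_{r,s}\in\mathbb C,$$ (absolutely convergent for all $z$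 in a neighbourhood of $0$), and for any such expansion $c_{0,0}$ is a positive real number and, for every Riemann mapping family $(R_1,R_2,h)$ for $\mu$, the limiting Riemann mapping $h(0,z)$ is given by the convergent series $$h(0,z)=\sum_{r=0}^\infty \frac{c_{r,0}}{\sqrt{c_{0,0}}}\,z^{r+1}\qquad\text{for all } |z|<R_2 .$$ -/

import Mathlib

open Filter Topology

namespace AsymptoticRiemann

/-- The domain `E_ε` around the origin bounded by the level set `μ = ε²`: the connected component
containing `0` of `{z ∈ U : μ z < ε²}`. (For a fixed neighbourhood `U` the sublevel set may have
further components far away from `0`.) -/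
def levelDomain (U : Set ℂ) (μ : ℂ → ℝ) (ε : ℝ) : Set ℂ :=
  connectedComponentIn {z : ℂ | z ∈ U ∧ μ z < ε ^ 2} 0

/-- `f` is the normalized univalent (holomorphic and injective) map of `E` onto the disk
`|w| < ε`: it is normalized by `f 0 = 0` and `f' 0 > 0`. -/
structure IsNormalizedRiemannMap (E : Set ℂ) (ε : ℝ) (f : ℂ → ℂ) : Prop where
  holo : DifferentiableOn ℂ f E
  bijOn : Set.BijOn f E (Metric.ball 0 ε)
  map_zero : f 0 = 0
  deriv_re_pos : 0 < (deriv f 0).re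
  deriv_im : (deriv f 0).im = 0

/-- `h` is a holomorphic function of two variables on the polydisk `|ε| < R₁`, `|z| < R₂` which,
for every real `0 < ε < R₁`, restricts to the normalized Riemann mapping of `E_ε` onto the disk
of radius `ε`. -/
structure IsRiemannFamily (U : Set ℂ) (μ : ℂ → ℝ) (R₁ R₂ : ℝ) (h : ℂ → ℂ → ℂ) : Prop where
  pos₁ : 0 < R₁
  pos₂ : 0 < R₂
  holo : DifferentiableOn ℂ (fun p : ℂ × ℂ => h p.1 p.2)
    (Metric.ball (0 : ℂ) R₁ ×ˢ Metric.ball (0 : ℂ) R₂)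
  subset : ∀ ε : ℝ, 0 < ε → ε < R₁ → levelDomain U μ ε ⊆ Metric.ball 0 R₂
  riemann : ∀ ε : ℝ, 0 < ε → ε < R₁ →
    IsNormalizedRiemannMap (levelDomain U μ ε) ε (h (ε : ℂ))

/-- `μ z = ∑ c r s z^(r+1) (conj z)^(s+1)`, summed (absolutely) over all `r, s ≥ 0`, for all `z`
in some neighbourhood of `0`: the Taylor expansion of `μ` at `0` in the variables `z`, `conj z`. -/
def IsTaylorExpansion (μ : ℂ → ℝ) (c : ℕ → ℕ → ℂ) : Prop :=
  ∀ᶠ z in 𝓝 (0 : ℂ),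
    HasSum (fun p : ℕ × ℕ => c p.1 p.2 * z ^ (p.1 + 1) * (starRingEnd ℂ z) ^ (p.2 + 1))
      ((μ z : ℝ) : ℂ)

end AsymptoticRiemann

namespace AsymptoticRiemann

open ComplexConjugate

/-! Write `k z = K z (conj z)` with `K z w = ∑ c r s z^r w^s`. The map is sought in the form `h ε z
= z * exp (a (ε²) z)`. On the level curve `|z|² k z = τ = ε²` the requirement `|h| = ε` says exactly
that `2 Re (a τ z) = log k z`, so everything rests on a function `a`, holomorphic in both variables,
that solves this equation.

To find it, put `L = log K` and treat `z` and `w` as independent. Removing the axes gives `L z w = L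
z 0 + L 0 w - L 0 0 + z w L' z w`, and the last term is `(z w K) * (L' / K)`. On `z w K = τ` this is
`τ` times another double power series, to which the same splitting applies. Each round multiplies
the weighted `ℓ¹` norm by at most a fixed `A`, so for `|τ| A < 1` the iteration converges: `L = ∑
τ^n (F n z 0 + F n 0 w - F n 0 0)`. With `w = conj z` and `τ` real, conjugating the terms in `conj
z` keeps the real part and makes the sum holomorphic in `(τ, z)` (`exists_two_mul_re_eq`). At `τ =
0`, Hermitian symmetry of `c` leaves `a 0 z = L z 0 - L 0 0 / 2`, that is `exp (a 0 z) = K z 0 / √(c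
0 0)`, which is the asserted limit.

It remains to see that `h ε` is the Riemann mapping. Bounds uniform in `ε` give univalence on a
fixed disk (`exists_injOn_ball`), and a univalent map of constant modulus `ε` on the frontier fills
the disk (`bijOn_ball_of_norm_eq_on_frontier`). For an arbitrary family, the Schwarz lemma gives
uniqueness for `ε > 0`; the identity theorem and the limit `ε → 0` carry it to `h 0` near the
origin, and the Taylor series of `h 0` to the full disk. -/

theorem _root_.HasSum.congr_forall {α β : Type*} [AddCommMonoid β] [TopologicalSpace β]
    {f g : α → β} {a : β} (hf : HasSum f a) (h : ∀ x, g x = f x) : HasSum g a :=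
  (funext h : g = f) ▸ hf

/-! ### Double power series with finite weighted `ℓ¹` norm -/

/-- `F` is the sum on the closed bidisk of radius `ρ` of the double power series with coefficients
`f`, whose weighted `ℓ¹` norm is at most `C`. -/
structure HasBidiskSum (ρ C : ℝ) (f : ℕ × ℕ → ℂ) (F : ℂ → ℂ → ℂ) : Prop where
  summable : Summable fun p : ℕ × ℕ => ‖f p‖ * ρ ^ (p.1 + p.2)
  bound : ∑' p : ℕ × ℕ, ‖f p‖ * ρ ^ (p.1 + p.2) ≤ C
  hasSum : ∀ z w : ℂ, ‖z‖ ≤ ρ → ‖w‖ ≤ ρ →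
    HasSum (fun p : ℕ × ℕ => f p * (z ^ p.1 * w ^ p.2)) (F z w)

theorem norm_monomial_le {ρ : ℝ} {z w : ℂ} (hz : ‖z‖ ≤ ρ) (hw : ‖w‖ ≤ ρ) (a : ℂ) (p : ℕ × ℕ) :
    ‖a * (z ^ p.1 * w ^ p.2)‖ ≤ ‖a‖ * ρ ^ (p.1 + p.2) := by
  have hρ : 0 ≤ ρ := (norm_nonneg z).trans hz
  rw [norm_mul, norm_mul, norm_pow, norm_pow, pow_add]
  gcongr

theorem summable_norm_monomial {ρ : ℝ} {f : ℕ × ℕ → ℂ}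
    (hf : Summable fun p : ℕ × ℕ => ‖f p‖ * ρ ^ (p.1 + p.2)) {z w : ℂ}
    (hz : ‖z‖ ≤ ρ) (hw : ‖w‖ ≤ ρ) :
    Summable fun p : ℕ × ℕ => ‖f p * (z ^ p.1 * w ^ p.2)‖ :=
  Summable.of_nonneg_of_le (fun _ => norm_nonneg _) (fun p => norm_monomial_le hz hw (f p) p) hf

namespace HasBidiskSum

variable {ρ C C' : ℝ} {f g : ℕ × ℕ → ℂ} {F G : ℂ → ℂ → ℂ}

theorem of_summable (hf : Summable fun p : ℕ × ℕ => ‖f p‖ * ρ ^ (p.1 + p.2)) :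
    HasBidiskSum ρ (∑' p : ℕ × ℕ, ‖f p‖ * ρ ^ (p.1 + p.2)) f
      (fun z w => ∑' p : ℕ × ℕ, f p * (z ^ p.1 * w ^ p.2)) :=
  ⟨hf, le_rfl, fun _ _ hz hw => (summable_norm_monomial hf hz hw).of_norm.hasSum⟩

theorem norm_le (hF : HasBidiskSum ρ C f F) {z w : ℂ} (hz : ‖z‖ ≤ ρ) (hw : ‖w‖ ≤ ρ) :
    ‖F z w‖ ≤ C := by
  rw [← (hF.hasSum z w hz hw).tsum_eq]
  have hs := summable_norm_monomial hF.summable hz hw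
  refine (norm_tsum_le_tsum_norm hs).trans (le_trans ?_ hF.bound)
  exact hs.tsum_le_tsum (fun p => norm_monomial_le hz hw (f p) p) hF.summable

theorem nonneg (hF : HasBidiskSum ρ C f F) (hρ : 0 ≤ ρ) : 0 ≤ C :=
  (tsum_nonneg fun _ => by positivity).trans hF.bound

/-- The weight is multiplicative under addition of exponents, so the weighted `ℓ¹` norm is
submultiplicative. The Cauchy product is organised by the fibres of addition on pairs of exponents.
-/
theorem mul (hG : HasBidiskSum ρ C' g G) (hF : HasBidiskSum ρ C f F) (hρ : 0 ≤ ρ) :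
    ∃ e, HasBidiskSum ρ (C' * C) e (fun z w => G z w * F z w) := by
  let σ : (ℕ × ℕ) × (ℕ × ℕ) → ℕ × ℕ := fun x => x.1 + x.2
  let T : (ℕ × ℕ) × (ℕ × ℕ) → ℂ := fun x => g x.1 * f x.2
  let N : (ℕ × ℕ) × (ℕ × ℕ) → ℝ := fun x =>
    (‖g x.1‖ * ρ ^ (x.1.1 + x.1.2)) * (‖f x.2‖ * ρ ^ (x.2.1 + x.2.2))
  have hN : Summable N := hG.summable.mul_of_nonneg hF.summable
    (fun _ => by positivity) (fun _ => by positivity)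
  have hNσ := hN.hasSum.tsum_fiberwise σ
  have hNT : ∀ q, ∀ x : σ ⁻¹' {q}, N x = ‖T x‖ * ρ ^ (q.1 + q.2) := by
    rintro q ⟨x, rfl⟩
    simp only [N, T, σ, norm_mul, Prod.fst_add, Prod.snd_add, pow_add]
    ring
  have hle : ∀ q, ‖∑' x : σ ⁻¹' {q}, T x‖ * ρ ^ (q.1 + q.2) ≤ ∑' x : σ ⁻¹' {q}, N x := by
    intro q
    rw [tsum_congr (hNT q), tsum_mul_right]
    -- `ρ = 0` is allowed, so the weight may vanish; otherwise it can be cancelled to recover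
    -- summability on the fibre.
    by_cases h0 : ρ ^ (q.1 + q.2) = 0
    · simp [h0]
    gcongr
    refine norm_tsum_le_tsum_norm ?_
    have : Summable fun x : σ ⁻¹' {q} => ‖T x‖ * ρ ^ (q.1 + q.2) :=
      (hN.comp_injective Subtype.val_injective).congr (fun x => hNT q x)
    exact (summable_mul_right_iff h0).1 this
  have hsum : Summable fun q : ℕ × ℕ => ‖∑' x : σ ⁻¹' {q}, T x‖ * ρ ^ (q.1 + q.2) :=
    Summable.of_nonneg_of_le (fun _ => by positivity) hle hNσ.summable
  refine ⟨fun q => ∑' x : σ ⁻¹' {q}, T x, hsum, ?_, fun z w hz hw => ?_⟩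
  · refine (hsum.tsum_le_tsum hle hNσ.summable).trans ?_
    have h2 : (∑' p : ℕ × ℕ, ‖g p‖ * ρ ^ (p.1 + p.2)) * ∑' p : ℕ × ℕ, ‖f p‖ * ρ ^ (p.1 + p.2) =
        ∑' x, N x := hG.summable.tsum_mul_tsum hF.summable hN
    rw [hNσ.tsum_eq, ← h2]
    have h0 : 0 ≤ ∑' p : ℕ × ℕ, ‖f p‖ * ρ ^ (p.1 + p.2) := tsum_nonneg fun _ => by positivity
    exact mul_le_mul hG.bound hF.bound h0 (hG.nonneg hρ)
  · have hg := summable_norm_monomial hG.summable hz hw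
    have hf := summable_norm_monomial hF.summable hz hw
    have hS : Summable fun x : (ℕ × ℕ) × (ℕ × ℕ) => (g x.1 * (z ^ x.1.1 * w ^ x.1.2)) *
        (f x.2 * (z ^ x.2.1 * w ^ x.2.2)) :=
      summable_mul_of_summable_norm (f := fun p : ℕ × ℕ => g p * (z ^ p.1 * w ^ p.2))
        (g := fun p : ℕ × ℕ => f p * (z ^ p.1 * w ^ p.2)) hg hf
    have hz1 := hG.hasSum z w hz hw
    have hz2 := hF.hasSum z w hz hw
    have h0 := hS.hasSum
    rw [← hz1.summable.tsum_mul_tsum hz2.summable hS, hz1.tsum_eq, hz2.tsum_eq] at h0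
    have h1 := h0.tsum_fiberwise σ
    refine h1.congr_forall fun q => ?_
    rw [← tsum_mul_right]
    refine tsum_congr ?_
    rintro ⟨x, rfl⟩
    simp only [T, σ, Prod.fst_add, Prod.snd_add, pow_add]
    ring

theorem congr (hF : HasBidiskSum ρ C f F)
    (h : ∀ z w : ℂ, ‖z‖ ≤ ρ → ‖w‖ ≤ ρ → F z w = G z w) : HasBidiskSum ρ C f G :=
  ⟨hF.summable, hF.bound, fun z w hz hw => h z w hz hw ▸ hF.hasSum z w hz hw⟩

theorem mono (hF : HasBidiskSum ρ C f F) (h : C ≤ C') : HasBidiskSum ρ C' f F :=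
  ⟨hF.summable, hF.bound.trans h, hF.hasSum⟩

theorem const_mul (a : ℂ) (hF : HasBidiskSum ρ C f F) :
    HasBidiskSum ρ (‖a‖ * C) (fun p => a * f p) (fun z w => a * F z w) := by
  refine ⟨?_, ?_, fun z w hz hw => ?_⟩
  · simpa only [norm_mul, mul_assoc] using hF.summable.mul_left ‖a‖
  · simp only [norm_mul, mul_assoc, tsum_mul_left]
    exact mul_le_mul_of_nonneg_left hF.bound (norm_nonneg a)
  · simpa only [mul_assoc] using (hF.hasSum z w hz hw).mul_left a

theorem one (ρ : ℝ) : HasBidiskSum ρ 1 (fun p => if p = 0 then 1 else 0) (fun _ _ => 1) := by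
  have h : HasSum (fun p : ℕ × ℕ => ‖if p = 0 then (1 : ℂ) else 0‖ * ρ ^ (p.1 + p.2)) 1 := by
    convert hasSum_ite_eq (0 : ℕ × ℕ) (1 : ℝ) using 2 with p
    split_ifs with hp <;> simp [hp]
  refine ⟨h.summable, h.tsum_eq.le, fun z w _ _ => ?_⟩
  convert hasSum_ite_eq (0 : ℕ × ℕ) (1 : ℂ) using 2 with p
  split_ifs with hp <;> simp [hp]

theorem pow (hF : HasBidiskSum ρ C f F) (hρ : 0 ≤ ρ) (n : ℕ) :
    ∃ e, HasBidiskSum ρ (C ^ n) e (fun z w => F z w ^ n) := by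
  induction n with
  | zero => exact ⟨_, by simpa using one ρ⟩
  | succ n ih =>
    obtain ⟨e, he⟩ := ih
    simpa only [pow_succ] using he.mul hF hρ

theorem tsum {u : ℕ → ℝ} {e : ℕ → ℕ × ℕ → ℂ} {F : ℕ → ℂ → ℂ → ℂ} (hρ : 0 ≤ ρ)
    (hF : ∀ n, HasBidiskSum ρ (u n) (e n) (F n)) (hu : Summable u) :
    HasBidiskSum ρ (∑' n, u n) (fun p => ∑' n, e n p) (fun z w => ∑' n, F n z w) := by
  let N : ℕ × (ℕ × ℕ) → ℝ := fun x => ‖e x.1 x.2‖ * ρ ^ (x.2.1 + x.2.2)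
  have hN0 : 0 ≤ N := fun _ => by positivity
  have hrow : Summable fun n => ∑' p : ℕ × ℕ, N (n, p) :=
    Summable.of_nonneg_of_le (fun n => tsum_nonneg fun p => hN0 _) (fun n => (hF n).bound) hu
  have hN : Summable N := (summable_prod_of_nonneg hN0).2 ⟨fun n => (hF n).summable, hrow⟩
  have hN' : Summable fun x : (ℕ × ℕ) × ℕ => N x.swap := hN.prod_symm
  have hcol := ((summable_prod_of_nonneg (fun x => hN0 x.swap)).1 hN').2
  have hle : ∀ p : ℕ × ℕ, ‖∑' n, e n p‖ * ρ ^ (p.1 + p.2) ≤ ∑' n, N (n, p) := by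
    intro p
    simp only [N, tsum_mul_right]
    by_cases h0 : ρ ^ (p.1 + p.2) = 0
    · simp [h0]
    gcongr
    refine norm_tsum_le_tsum_norm ?_
    exact (summable_mul_right_iff h0).1 (hN'.prod_factor p)
  have hsum : Summable fun p : ℕ × ℕ => ‖∑' n, e n p‖ * ρ ^ (p.1 + p.2) :=
    Summable.of_nonneg_of_le (fun _ => by positivity) hle hcol
  refine ⟨hsum, ?_, fun z w hz hw => ?_⟩
  · refine (hsum.tsum_le_tsum hle hcol).trans ?_
    refine le_trans (le_of_eq ?_) (hrow.tsum_le_tsum (fun n => (hF n).bound) hu)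
    exact Summable.tsum_comm (f := fun n p => N (n, p)) hN
  · have hT : Summable fun x : ℕ × (ℕ × ℕ) => e x.1 x.2 * (z ^ x.2.1 * w ^ x.2.2) :=
      Summable.of_norm_bounded hN fun x => norm_monomial_le hz hw _ _
    have h1 := hT.hasSum.prod_fiberwise fun n => (hF n).hasSum z w hz hw
    rw [h1.tsum_eq]
    have h2 := hT.prod_symm
    rw [← (Equiv.prodComm ℕ (ℕ × ℕ)).symm.tsum_eq]
    refine h2.hasSum.prod_fiberwise fun p => ?_
    rw [← tsum_mul_right]
    exact (h2.prod_factor p).hasSum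

/-- A double power series splits into its restrictions to the axes and a multiple of `z * w`. -/
theorem exists_axes_add_mul (hF : HasBidiskSum ρ C f F) (hρ : 0 < ρ) :
    ∃ F', HasBidiskSum ρ (C / ρ ^ 2) (fun p => f (p + (1, 1))) F' ∧
      ∀ z w : ℂ, ‖z‖ ≤ ρ → ‖w‖ ≤ ρ → F z w = F z 0 + F 0 w - F 0 0 + z * w * F' z w := by
  have hinj : Function.Injective fun p : ℕ × ℕ => p + (1, 1) := add_left_injective _
  have key : ∀ p : ℕ × ℕ, ‖f (p + (1, 1))‖ * ρ ^ (p.1 + p.2) =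
      ‖f (p + (1, 1))‖ * ρ ^ ((p + (1, 1)).1 + (p + (1, 1)).2) / ρ ^ 2 := by
    intro p
    have : (p + (1, 1)).1 + (p + (1, 1)).2 = p.1 + p.2 + 2 := by
      simp only [Prod.fst_add, Prod.snd_add]; ring
    rw [this, pow_add _ _ 2, ← mul_assoc, mul_div_cancel_right₀ _ (by positivity)]
  have hs : Summable fun p : ℕ × ℕ =>
      ‖f (p + (1, 1))‖ * ρ ^ ((p + (1, 1)).1 + (p + (1, 1)).2) :=
    hF.summable.comp_injective hinj
  have hsum : Summable fun p : ℕ × ℕ => ‖f (p + (1, 1))‖ * ρ ^ (p.1 + p.2) :=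
    (hs.div_const (ρ ^ 2)).congr fun p => (key p).symm
  have hb : ∑' p : ℕ × ℕ, ‖f (p + (1, 1))‖ * ρ ^ (p.1 + p.2) ≤ C / ρ ^ 2 := by
    rw [tsum_congr key, tsum_div_const]
    gcongr
    refine le_trans ?_ hF.bound
    exact tsum_comp_le_tsum_of_inj hF.summable (fun _ => by positivity) hinj
  refine ⟨_, (of_summable hsum).mono hb, fun z w hz hw => ?_⟩
  have h0 : ‖(0 : ℂ)‖ ≤ ρ := by simpa using hρ.le
  have H := (((hF.hasSum z w hz hw).sub (hF.hasSum z 0 hz h0)).sub (hF.hasSum 0 w h0 hw)).add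
    (hF.hasSum 0 0 h0 h0)
  have H2 := ((of_summable hsum).hasSum z w hz hw).mul_left (z * w)
  -- By inclusion–exclusion, with `0 ^ 0 = 1`, the four terms cancel for every monomial having a
  -- zero exponent and leave only the multiples of `z * w`.
  have H3 : HasSum (fun p : ℕ × ℕ => f p * (z ^ p.1 * w ^ p.2) - f p * (z ^ p.1 * 0 ^ p.2) -
      f p * (0 ^ p.1 * w ^ p.2) + f p * (0 ^ p.1 * 0 ^ p.2))
      (z * w * ∑' p : ℕ × ℕ, f (p + (1, 1)) * (z ^ p.1 * w ^ p.2)) := by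
    rw [← hinj.hasSum_iff]
    · refine H2.congr_forall fun p => ?_
      simp only [Function.comp_apply, Prod.fst_add, Prod.snd_add, pow_succ, mul_zero, zero_mul,
        sub_zero, add_zero]
      ring
    · rintro ⟨_ | r, _ | s⟩ hp
      · simp
      · simp
      · simp
      · exact absurd ⟨(r, s), rfl⟩ hp
  linear_combination H.unique H3

end HasBidiskSum

namespace HasBidiskSum

variable {ρ C C' : ℝ} {f g : ℕ × ℕ → ℂ} {F G K L : ℂ → ℂ → ℂ}

theorem anti {ρ' : ℝ} (hF : HasBidiskSum ρ C f F) (h0 : 0 ≤ ρ') (h : ρ' ≤ ρ) :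
    HasBidiskSum ρ' C f F := by
  have hle : ∀ p : ℕ × ℕ, ‖f p‖ * ρ' ^ (p.1 + p.2) ≤ ‖f p‖ * ρ ^ (p.1 + p.2) := fun p => by gcongr
  have hs := Summable.of_nonneg_of_le (fun p => by positivity) hle hF.summable
  exact ⟨hs, (hs.tsum_le_tsum hle hF.summable).trans hF.bound,
    fun z w hz hw => hF.hasSum z w (hz.trans h) (hw.trans h)⟩

theorem hasSum_fst (hF : HasBidiskSum ρ C f F) {z : ℂ} (hz : ‖z‖ ≤ ρ) :
    HasSum (fun r => f (r, 0) * z ^ r) (F z 0) := by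
  have hinj : Function.Injective fun r : ℕ => (r, 0) := fun a b h => by simpa using h
  have h := hF.hasSum z 0 hz (by simpa using (norm_nonneg z).trans hz)
  rw [← hinj.hasSum_iff] at h
  · simpa [Function.comp_def] using h
  · rintro ⟨r, _ | s⟩ hp
    · exact absurd ⟨r, rfl⟩ hp
    · simp

theorem hasSum_snd (hF : HasBidiskSum ρ C f F) {w : ℂ} (hw : ‖w‖ ≤ ρ) :
    HasSum (fun s => f (0, s) * w ^ s) (F 0 w) := by
  have hinj : Function.Injective fun s : ℕ => (0, s) := fun a b h => by simpa using h
  have h := hF.hasSum 0 w (by simpa using (norm_nonneg w).trans hw) hw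
  rw [← hinj.hasSum_iff] at h
  · simpa [Function.comp_def] using h
  · rintro ⟨_ | r, s⟩ hp
    · exact absurd ⟨s, rfl⟩ hp
    · simp

theorem apply_zero_zero (hF : HasBidiskSum ρ C f F) (hρ : 0 ≤ ρ) : F 0 0 = f 0 := by
  refine (hF.hasSum_fst (z := 0) (by simpa using hρ)).unique ?_
  convert hasSum_ite_eq (0 : ℕ) (f 0) using 2 with r
  split_ifs with h
  · subst h; simp [Prod.mk_zero_zero]
  · simp [h]

/-- The series is differentiated term by term on a smaller bidisk of radius `t < ρ`. The factor `n`
produced by differentiation is absorbed because `n * (t / ρ) ^ n` is bounded. -/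
theorem differentiableOn (hF : HasBidiskSum ρ C f F) :
    DifferentiableOn ℂ (fun p : ℂ × ℂ => F p.1 p.2) (Metric.ball 0 ρ ×ˢ Metric.ball 0 ρ) := by
  rintro ⟨z₀, w₀⟩ ⟨hz₀, hw₀⟩
  rw [mem_ball_zero_iff] at hz₀ hw₀
  obtain ⟨t, ht, htρ⟩ := exists_between (max_lt hz₀ hw₀)
  have ht0 : 0 < t := ((norm_nonneg z₀).trans (le_max_left _ _)).trans_lt ht
  have hρ : 0 < ρ := ht0.trans htρ
  have hθ : ‖t / ρ‖ < 1 := by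
    rw [Real.norm_of_nonneg (by positivity), div_lt_one hρ]
    exact htρ
  have hgeom := (summable_pow_mul_geometric_of_norm_lt_one 1 hθ).tendsto_atTop_zero
  obtain ⟨M, hM⟩ := hgeom.bddAbove_range
  have hM' : ∀ n : ℕ, n * t ^ n ≤ M * ρ ^ n := by
    intro n
    have : (n : ℝ) ^ 1 * (t / ρ) ^ n ≤ M := hM ⟨n, rfl⟩
    rwa [pow_one, div_pow, ← mul_div_assoc, div_le_iff₀ (by positivity)] at this
  let s : Set (ℂ × ℂ) := Metric.ball 0 t ×ˢ Metric.ball 0 t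
  have hs : IsOpen s := Metric.isOpen_ball.prod Metric.isOpen_ball
  have hsc : Convex ℝ s := (convex_ball _ _).prod (convex_ball _ _)
  let φ : ℂ × ℂ →L[ℂ] ℂ := ContinuousLinearMap.fst ℂ ℂ ℂ
  let ψ : ℂ × ℂ →L[ℂ] ℂ := ContinuousLinearMap.snd ℂ ℂ ℂ
  let T : ℕ × ℕ → ℂ × ℂ → ℂ := fun p x => f p * (x.1 ^ p.1 * x.2 ^ p.2)
  let T' : ℕ × ℕ → ℂ × ℂ → ℂ × ℂ →L[ℂ] ℂ := fun p x =>
    f p • (x.1 ^ p.1 • ((p.2 * x.2 ^ (p.2 - 1)) • ψ) + x.2 ^ p.2 • ((p.1 * x.1 ^ (p.1 - 1)) • φ))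
  have hT : ∀ p x, x ∈ s → HasFDerivAt (T p) (T' p x) x := by
    intro p x _
    have h1 : HasFDerivAt (fun x : ℂ × ℂ => x.1 ^ p.1) ((p.1 * x.1 ^ (p.1 - 1)) • φ) x :=
      (hasDerivAt_pow p.1 x.1).comp_hasFDerivAt x φ.hasFDerivAt
    have h2 : HasFDerivAt (fun x : ℂ × ℂ => x.2 ^ p.2) ((p.2 * x.2 ^ (p.2 - 1)) • ψ) x :=
      (hasDerivAt_pow p.2 x.2).comp_hasFDerivAt x ψ.hasFDerivAt
    exact (h1.mul h2).const_mul (f p)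
  have hpow : ∀ (n : ℕ) (x : ℂ), ‖x‖ ≤ t → ‖(n * x ^ (n - 1) : ℂ)‖ ≤ M * ρ ^ n / t := by
    intro n x hx
    rw [le_div_iff₀ ht0]
    refine le_trans ?_ (hM' n)
    rcases n with _ | n
    · simp
    · rw [norm_mul, norm_pow, Complex.norm_natCast, Nat.add_sub_cancel, pow_succ t, mul_assoc]
      gcongr
  have hMρ : ∀ n : ℕ, 0 ≤ M * ρ ^ n := fun n => le_trans (by positivity) (hM' n)
  have hφ : ‖φ‖ ≤ 1 := ContinuousLinearMap.norm_fst_le ℂ ℂ ℂ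
  have hψ : ‖ψ‖ ≤ 1 := ContinuousLinearMap.norm_snd_le ℂ ℂ ℂ
  have hT' : ∀ p x, x ∈ s → ‖T' p x‖ ≤ (‖f p‖ * ρ ^ (p.1 + p.2)) * (2 * M / t) := by
    rintro p ⟨x, y⟩ ⟨hx, hy⟩
    rw [mem_ball_zero_iff] at hx hy
    have e1 : ‖x ^ p.1 • ((p.2 * y ^ (p.2 - 1)) • ψ)‖ ≤ ρ ^ p.1 * (M * ρ ^ p.2 / t * 1) := by
      rw [norm_smul, norm_smul, norm_pow]
      gcongr
      · exact hx.le.trans htρ.le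
      · exact div_nonneg (hMρ _) ht0.le
      · exact hpow _ _ hy.le
    have e2 : ‖y ^ p.2 • ((p.1 * x ^ (p.1 - 1)) • φ)‖ ≤ ρ ^ p.2 * (M * ρ ^ p.1 / t * 1) := by
      rw [norm_smul, norm_smul, norm_pow]
      gcongr
      · exact hy.le.trans htρ.le
      · exact div_nonneg (hMρ _) ht0.le
      · exact hpow _ _ hx.le
    calc ‖T' p (x, y)‖ ≤ ‖f p‖ * (ρ ^ p.1 * (M * ρ ^ p.2 / t * 1)
          + ρ ^ p.2 * (M * ρ ^ p.1 / t * 1)) := by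
          rw [norm_smul]
          gcongr
          exact (norm_add_le _ _).trans (add_le_add e1 e2)
      _ = _ := by rw [pow_add]; ring
  have hx₀ : ((z₀, w₀) : ℂ × ℂ) ∈ s :=
    ⟨mem_ball_zero_iff.2 ((le_max_left _ _).trans_lt ht),
      mem_ball_zero_iff.2 ((le_max_right _ _).trans_lt ht)⟩
  have key := hasFDerivAt_tsum_of_isPreconnected (hF.summable.mul_right (2 * M / t)) hs
    hsc.isPreconnected hT hT' hx₀ (hF.hasSum z₀ w₀ hz₀.le hw₀.le).summable hx₀
  refine (key.differentiableAt.congr_of_eventuallyEq ?_).differentiableWithinAt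
  filter_upwards [hs.mem_nhds hx₀] with x hx
  have h1 := (mem_ball_zero_iff.1 hx.1).le.trans htρ.le
  have h2 := (mem_ball_zero_iff.1 hx.2).le.trans htρ.le
  exact (hF.hasSum x.1 x.2 h1 h2).tsum_eq.symm

/-! ### Expansion along the curves `z * w * K z w = τ` -/

/-- Dividing by `K` and removing the axes repeatedly: the sequence `F n` with `F 0 = L` and
`F n z w - F n z 0 - F n 0 w + F n 0 0 = z * w * K z w * F (n + 1) z w`. -/
theorem exists_iterated_quotients {B : ℝ} (hL : HasBidiskSum ρ C f L) (hG : HasBidiskSum ρ B g G)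
    (hρ : 0 < ρ) (hGK : ∀ z w : ℂ, ‖z‖ ≤ ρ → ‖w‖ ≤ ρ → G z w * K z w = 1) :
    ∃ A : ℝ, 0 < A ∧ ∃ (e : ℕ → ℕ × ℕ → ℂ) (F : ℕ → ℂ → ℂ → ℂ), F 0 = L ∧
      (∀ n, HasBidiskSum ρ (C * A ^ n) (e n) (F n)) ∧
      ∀ n, ∀ z w : ℂ, ‖z‖ ≤ ρ → ‖w‖ ≤ ρ →
        F n z w = F n z 0 + F n 0 w - F n 0 0 + z * w * K z w * F (n + 1) z w := by
  have hC := hL.nonneg hρ.le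
  have hB := hG.nonneg hρ.le
  -- Removing the axes costs a factor `ρ⁻²` and multiplying by `G = 1 / K` a factor `B`; the `1`
  -- keeps `A` positive.
  set A : ℝ := B / ρ ^ 2 + 1
  have hA : 0 < A := by positivity
  let P : ℕ → (ℕ × ℕ → ℂ) × (ℂ → ℂ → ℂ) → Prop := fun n x => HasBidiskSum ρ (C * A ^ n) x.1 x.2
  have step : ∀ n (x : {x // P n x}), ∃ y : {y // P (n + 1) y}, ∀ z w : ℂ, ‖z‖ ≤ ρ → ‖w‖ ≤ ρ →
      x.1.2 z w = x.1.2 z 0 + x.1.2 0 w - x.1.2 0 0 + z * w * K z w * y.1.2 z w := by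
    rintro n ⟨⟨e, F⟩, hF⟩
    obtain ⟨F', hF', hax⟩ := exists_axes_add_mul hF hρ
    obtain ⟨e'', he''⟩ := hG.mul hF' hρ.le
    refine ⟨⟨(e'', _), he''.mono ?_⟩, fun z w hz hw => ?_⟩
    · have : B * (C * A ^ n / ρ ^ 2) = C * A ^ n * (B / ρ ^ 2) := by ring
      rw [this, pow_succ A, ← mul_assoc]
      gcongr
      simp [A]
    · have := hax z w hz hw
      simp only at this ⊢
      linear_combination this - z * w * F' z w * hGK z w hz hw
  choose next hnext using step
  let x : ∀ n, {x // P n x} := fun n =>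
    Nat.rec (motive := fun n => {x // P n x}) ⟨(f, L), by simpa [P] using hL⟩ next n
  exact ⟨A, hA, fun n => (x n).1.1, fun n => (x n).1.2, rfl, fun n => (x n).2,
    fun n z w hz hw => hnext n (x n) z w hz hw⟩

end HasBidiskSum

/-- The recursion telescopes: the partial sum up to `N` misses `F 0 z w` by `τ ^ N * F N z w`, of
size at most `C * (‖τ‖ * A) ^ N`. -/
theorem hasSum_axes_of_iterated_quotients {ρ C A : ℝ} {e : ℕ → ℕ × ℕ → ℂ} {F : ℕ → ℂ → ℂ → ℂ}
    {K : ℂ → ℂ → ℂ} (hρ : 0 < ρ) (hF : ∀ n, HasBidiskSum ρ (C * A ^ n) (e n) (F n))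
    (hrec : ∀ n, ∀ z w : ℂ, ‖z‖ ≤ ρ → ‖w‖ ≤ ρ →
        F n z w = F n z 0 + F n 0 w - F n 0 0 + z * w * K z w * F (n + 1) z w)
    {z w τ : ℂ} (hz : ‖z‖ ≤ ρ) (hw : ‖w‖ ≤ ρ) (hτ : z * w * K z w = τ) (hA : 0 < A)
    (hτA : ‖τ‖ * A < 1) :
    HasSum (fun n => τ ^ n * (F n z 0 + F n 0 w - F n 0 0)) (F 0 z w) := by
  have h0 : ‖(0 : ℂ)‖ ≤ ρ := by simpa using hρ.le
  have hgeom : Summable fun n : ℕ => (‖τ‖ * A) ^ n :=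
    summable_geometric_of_lt_one (by positivity) hτA
  have hsum : Summable fun n => τ ^ n * (F n z 0 + F n 0 w - F n 0 0) := by
    refine Summable.of_norm_bounded (hgeom.mul_left (3 * C)) fun n => ?_
    have h1 := (hF n).norm_le hz h0
    have h2 := (hF n).norm_le h0 hw
    have h3 := (hF n).norm_le h0 h0
    have h4 : ‖F n z 0 + F n 0 w - F n 0 0‖ ≤ 3 * (C * A ^ n) := by
      refine (norm_sub_le _ _).trans ?_
      linarith [norm_add_le (F n z 0) (F n 0 w)]
    rw [norm_mul, norm_pow, mul_pow]
    calc ‖τ‖ ^ n * _ ≤ ‖τ‖ ^ n * (3 * (C * A ^ n)) := by gcongr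
      _ = _ := by ring
  have hpart : ∀ N, ∑ n ∈ Finset.range N, τ ^ n * (F n z 0 + F n 0 w - F n 0 0) =
      F 0 z w - τ ^ N * F N z w := by
    intro N
    induction N with
    | zero => simp
    | succ N ih =>
      rw [Finset.sum_range_succ, ih, pow_succ]
      have := hrec N z w hz hw
      rw [hτ] at this
      linear_combination (-τ ^ N) * this
  rw [hsum.hasSum_iff_tendsto_nat]
  simp only [hpart]
  have hlim : Tendsto (fun N => τ ^ N * F N z w) atTop (𝓝 0) := by
    refine squeeze_zero_norm (fun N => ?_) (by simpa using hgeom.tendsto_atTop_zero.const_mul C)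
    rw [norm_mul, norm_pow, mul_pow]
    calc ‖τ‖ ^ N * _ ≤ ‖τ‖ ^ N * (C * A ^ N) := by
          gcongr
          exact (hF N).norm_le hz hw
      _ = _ := by ring
  simpa using hlim.const_sub (F 0 z w)

/-- On the curves `z * w * K z w = τ` with `τ` real and `w = conj z`, the real part of `L` is the
real part of a function `2 * a τ z` that is holomorphic in `z` and `τ`. -/
theorem exists_two_mul_re_eq {ρ C B : ℝ} {f g : ℕ × ℕ → ℂ} {K L G : ℂ → ℂ → ℂ} (hρ : 0 < ρ)
    (hL : HasBidiskSum ρ C f L) (hG : HasBidiskSum ρ B g G)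
    (hGK : ∀ z w : ℂ, ‖z‖ ≤ ρ → ‖w‖ ≤ ρ → G z w * K z w = 1) :
    ∃ r : ℝ, 0 < r ∧ r ≤ ρ ∧ ∃ (D : ℝ) (d : ℕ × ℕ → ℂ) (a : ℂ → ℂ → ℂ), HasBidiskSum r D d a ∧
      (∀ t : ℝ, |t| ≤ r → (a t 0).im = 0) ∧
      (∀ (t : ℝ) (z : ℂ), |t| ≤ r → ‖z‖ ≤ r → z * conj z * K z (conj z) = t →
        2 * (a t z).re = (L z (conj z)).re) ∧
      ∀ z : ℂ, ‖z‖ ≤ r →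
        a 0 z = (L z 0 + conj (L 0 (conj z))) / 2 - (L 0 0 + conj (L 0 0)) / 4 := by
  obtain ⟨A, hA, e, F, hF0, hF, hrec⟩ := hL.exists_iterated_quotients hG hρ hGK
  have hC := hL.nonneg hρ.le
  -- Makes `‖τ‖ * A ≤ 1 / 2` for `‖τ‖ ≤ r`.
  let r : ℝ := min ρ (1 / (2 * A))
  have hr : 0 < r := by positivity
  have hrρ : r ≤ ρ := min_le_left _ _
  have hrA : r * A ≤ 1 / 2 := by
    calc r * A ≤ 1 / (2 * A) * A := by gcongr; exact min_le_right _ _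
      _ = 1 / 2 := by field_simp
  have hFr := fun n => (hF n).anti hr.le hrρ
  -- Coefficient of `τ ^ p.1 * z ^ p.2`. Conjugating `F n 0 (conj z)` turns it into a power series
  -- in `z` with the same real part. The constant term occurs on both axes and is subtracted once,
  -- hence the extra half at `p.2 = 0`.
  let d : ℕ × ℕ → ℂ := fun p =>
    (if p.2 = 0 then 1 / 2 else 1) * ((e p.1 (p.2, 0) + conj (e p.1 (0, p.2))) / 2)
  have h0 : ‖(0 : ℂ)‖ ≤ r := by simpa using hr.le
  have hd : ∀ (n : ℕ) (z : ℂ), ‖z‖ ≤ r → HasSum (fun k => d (n, k) * z ^ k)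
      ((F n z 0 + conj (F n 0 (conj z))) / 2 - (F n 0 0 + conj (F n 0 0)) / 4) := by
    intro n z hz
    have h1 := (hFr n).hasSum_fst hz
    have h2 := Complex.hasSum_conj'.2 ((hFr n).hasSum_snd (w := conj z) (by simpa using hz))
    have h3 := hasSum_ite_eq (0 : ℕ) ((F n 0 0 + conj (F n 0 0)) / 4)
    refine (((h1.add h2).div_const 2).sub h3).congr_forall fun k => ?_
    rw [(hFr n).apply_zero_zero hr.le]
    rcases eq_or_ne k 0 with rfl | hk
    · simp [d, Prod.mk_zero_zero]
      ring
    · simp [d, hk]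
      ring
  have hdle : ∀ p : ℕ × ℕ, ‖d p‖ * r ^ (p.1 + p.2) ≤
      r ^ p.1 * ((‖e p.1 (p.2, 0)‖ * r ^ p.2 + ‖e p.1 (0, p.2)‖ * r ^ p.2) / 2) := by
    intro p
    have h1 : ‖(if p.2 = 0 then 1 / 2 else 1 : ℂ)‖ ≤ 1 := by split_ifs <;> norm_num
    have h2 : ‖(e p.1 (p.2, 0) + conj (e p.1 (0, p.2))) / 2‖ ≤
        (‖e p.1 (p.2, 0)‖ + ‖e p.1 (0, p.2)‖) / 2 := by
      rw [norm_div, Complex.norm_two]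
      gcongr
      exact (norm_add_le _ _).trans (by rw [RCLike.norm_conj])
    calc ‖d p‖ * r ^ (p.1 + p.2)
        ≤ 1 * ((‖e p.1 (p.2, 0)‖ + ‖e p.1 (0, p.2)‖) / 2) * r ^ (p.1 + p.2) := by
          rw [norm_mul]
          gcongr
      _ = _ := by rw [pow_add]; ring
  have hinj₁ : Function.Injective fun k : ℕ => (k, 0) := fun a b h => by simpa using h
  have hinj₂ : Function.Injective fun k : ℕ => (0, k) := fun a b h => by simpa using h
  have hs₁ : ∀ n, Summable fun k => ‖e n (k, 0)‖ * r ^ k := fun n =>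
    ((hFr n).summable.comp_injective hinj₁).congr fun k => by simp
  have hs₂ : ∀ n, Summable fun k => ‖e n (0, k)‖ * r ^ k := fun n =>
    ((hFr n).summable.comp_injective hinj₂).congr fun k => by simp
  have hb₁ : ∀ n, ∑' k, ‖e n (k, 0)‖ * r ^ k ≤ C * A ^ n := fun n => by
    refine le_trans ?_ (hFr n).bound
    simpa [Function.comp_def] using
      tsum_comp_le_tsum_of_inj (hFr n).summable (fun _ => by positivity) hinj₁
  have hb₂ : ∀ n, ∑' k, ‖e n (0, k)‖ * r ^ k ≤ C * A ^ n := fun n => by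
    refine le_trans ?_ (hFr n).bound
    simpa [Function.comp_def] using
      tsum_comp_le_tsum_of_inj (hFr n).summable (fun _ => by positivity) hinj₂
  have hrow : ∀ n, Summable fun k =>
      r ^ n * ((‖e n (k, 0)‖ * r ^ k + ‖e n (0, k)‖ * r ^ k) / 2) := fun n =>
    (((hs₁ n).add (hs₂ n)).div_const 2).mul_left _
  have hdsum : Summable fun p : ℕ × ℕ => ‖d p‖ * r ^ (p.1 + p.2) := by
    refine Summable.of_nonneg_of_le (fun _ => by positivity) hdle ?_
    refine (summable_prod_of_nonneg fun _ => by positivity).2 ⟨hrow, ?_⟩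
    refine Summable.of_nonneg_of_le (fun n => tsum_nonneg fun _ => by positivity) (fun n => ?_)
      (summable_geometric_two.mul_left C)
    simp only
    rw [tsum_mul_left, tsum_div_const, (hs₁ n).tsum_add (hs₂ n)]
    calc r ^ n * ((∑' k, ‖e n (k, 0)‖ * r ^ k + ∑' k, ‖e n (0, k)‖ * r ^ k) / 2)
        ≤ r ^ n * ((C * A ^ n + C * A ^ n) / 2) := by
          gcongr
          · exact hb₁ n
          · exact hb₂ n
      _ = C * (r * A) ^ n := by rw [mul_pow]; ring
      _ ≤ C * (1 / 2) ^ n := by gcongr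
  have ha := HasBidiskSum.of_summable hdsum
  have hseries : ∀ (τ z : ℂ), ‖τ‖ ≤ r → ‖z‖ ≤ r → HasSum (fun n => τ ^ n *
      ((F n z 0 + conj (F n 0 (conj z))) / 2 - (F n 0 0 + conj (F n 0 0)) / 4))
      (∑' p : ℕ × ℕ, d p * (τ ^ p.1 * z ^ p.2)) := by
    intro τ z hτ hz
    refine (ha.hasSum τ z hτ hz).prod_fiberwise fun n => ?_
    exact ((hd n z hz).mul_left (τ ^ n)).congr_forall fun k => by ring
  refine ⟨r, hr, hrρ, _, d, _, ha, fun t ht => ?_, fun t z ht hz hzt => ?_, fun z hz => ?_⟩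
  -- At `z = 0` each coefficient of `τ ^ n` is a number plus its conjugate, up to a real factor.
  · have h1 := Complex.imCLM.hasSum (hseries t 0 (by simpa using ht) h0)
    refine h1.unique (hasSum_zero.congr_forall fun n => ?_)
    rw [← Complex.ofReal_pow, Complex.imCLM_apply, Complex.im_ofReal_mul]
    simp
  · have h1 := (Complex.reCLM.hasSum (hseries t z (by simpa using ht) hz)).mul_left 2
    have hτA : ‖(t : ℂ)‖ * A < 1 := by
      rw [Complex.norm_real]
      calc |t| * A ≤ r * A := by gcongr
        _ < 1 := by linarith
    have h2 := Complex.reCLM.hasSum (hasSum_axes_of_iterated_quotients hρ hF hrec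
      (hz.trans hrρ) (w := conj z) (by simpa using hz.trans hrρ) hzt hA hτA)
    rw [hF0] at h2
    refine h1.unique (h2.congr_forall fun n => ?_)
    rw [← Complex.ofReal_pow, Complex.reCLM_apply, Complex.reCLM_apply, Complex.re_ofReal_mul,
      Complex.re_ofReal_mul]
    simp
    ring
  · refine (ha.hasSum_snd hz).unique ?_
    simpa only [hF0] using hd 0 z hz

/-! ### Logarithm of the series and the modulus factor -/

/-- A double power series with positive constant term has, on a small bidisk, a reciprocal and a
logarithm that are again absolutely convergent double power series. -/
theorem exists_reciprocal_and_log {ρ₀ κ : ℝ} (hρ₀ : 0 < ρ₀) (hκ : 0 < κ) {c : ℕ × ℕ → ℂ}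
    (hc : Summable fun p : ℕ × ℕ => ‖c p‖ * ρ₀ ^ (p.1 + p.2)) (hc0 : c 0 = κ) :
    ∃ ρ : ℝ, 0 < ρ ∧ ρ ≤ ρ₀ ∧ ∃ (C : ℝ) (l g : ℕ × ℕ → ℂ) (K L G : ℂ → ℂ → ℂ),
      HasBidiskSum ρ C l L ∧ HasBidiskSum ρ C g G ∧
      ∀ z w : ℂ, ‖z‖ ≤ ρ → ‖w‖ ≤ ρ →
        HasSum (fun p : ℕ × ℕ => c p * (z ^ p.1 * w ^ p.2)) (K z w) ∧
        G z w * K z w = 1 ∧ ‖K z w / κ - 1‖ ≤ 1 / 2 ∧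
        L z w = Real.log κ + Complex.log (K z w / κ) := by
  set S : ℝ := ∑' p : ℕ × ℕ, ‖c p‖ * ρ₀ ^ (p.1 + p.2)
  have hS : 0 ≤ S := tsum_nonneg fun _ => by positivity
  have hκ' : (κ : ℂ) ≠ 0 := by exact_mod_cast hκ.ne'
  -- Every nonconstant monomial gains a factor `ρ / ρ₀` from shrinking the bidisk; this radius
  -- brings the norm of `X = 1 - K / κ` down to at most `1 / 2`.
  let ρ : ℝ := min ρ₀ (ρ₀ * κ / (2 * (S + 1)))
  have hρ : 0 < ρ := by positivity
  have hρρ₀ : ρ ≤ ρ₀ := min_le_left _ _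
  have hρS : ρ / ρ₀ * S / κ ≤ 1 / 2 := by
    have h1 : ρ ≤ ρ₀ * κ / (2 * (S + 1)) := min_le_right _ _
    rw [div_mul_eq_mul_div, div_div, div_le_iff₀ (by positivity)]
    rw [le_div_iff₀ (by positivity)] at h1
    nlinarith
  have hcρ := HasBidiskSum.anti (.of_summable hc) hρ.le hρρ₀
  let x : ℕ × ℕ → ℂ := fun p => if p = 0 then 0 else -c p / κ
  have hxle : ∀ p : ℕ × ℕ, ‖x p‖ * ρ ^ (p.1 + p.2) ≤
      ρ / ρ₀ / κ * (‖c p‖ * ρ₀ ^ (p.1 + p.2)) := by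
    intro p
    by_cases hp : p = 0
    · simp only [x, hp, if_true, norm_zero, zero_mul]
      positivity
    obtain ⟨n, hn⟩ : ∃ n, p.1 + p.2 = n + 1 := by
      refine Nat.exists_eq_succ_of_ne_zero fun h => hp ?_
      ext <;> simp <;> omega
    have hpow : ρ ^ (n + 1) ≤ ρ / ρ₀ * ρ₀ ^ (n + 1) := by
      rw [pow_succ, pow_succ, mul_comm (ρ₀ ^ n), ← mul_assoc, div_mul_cancel₀ _ hρ₀.ne', mul_comm]
      gcongr
    simp only [x, hp, if_false, norm_div, norm_neg, Complex.norm_real, Real.norm_of_nonneg hκ.le]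
    rw [hn]
    calc ‖c p‖ / κ * ρ ^ (n + 1) ≤ ‖c p‖ / κ * (ρ / ρ₀ * ρ₀ ^ (n + 1)) := by gcongr
      _ = _ := by ring
  have hxs : Summable fun p : ℕ × ℕ => ‖x p‖ * ρ ^ (p.1 + p.2) :=
    Summable.of_nonneg_of_le (fun _ => by positivity) hxle (hc.mul_left _)
  have hxb : ∑' p : ℕ × ℕ, ‖x p‖ * ρ ^ (p.1 + p.2) ≤ 1 / 2 := by
    refine (hxs.tsum_le_tsum hxle (hc.mul_left _)).trans ?_
    rw [tsum_mul_left]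
    refine le_trans (le_of_eq ?_) hρS
    ring
  obtain ⟨X, hX⟩ : ∃ X, HasBidiskSum ρ (1 / 2) x X :=
    ⟨_, (HasBidiskSum.of_summable hxs).mono hxb⟩
  have hXnorm : ∀ z w : ℂ, ‖z‖ ≤ ρ → ‖w‖ ≤ ρ → ‖X z w‖ ≤ 1 / 2 := fun z w hz hw => hX.norm_le hz hw
  let K : ℂ → ℂ → ℂ := fun z w => κ * (1 - X z w)
  have hKc : ∀ z w : ℂ, ‖z‖ ≤ ρ → ‖w‖ ≤ ρ →
      HasSum (fun p : ℕ × ℕ => c p * (z ^ p.1 * w ^ p.2)) (K z w) := by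
    intro z w hz hw
    refine (((hasSum_ite_eq (0 : ℕ × ℕ) (1 : ℂ)).sub (hX.hasSum z w hz hw)).mul_left
      (κ : ℂ)).congr_forall fun p => ?_
    by_cases hp : p = 0
    · simp [x, hp, hc0]
    · simp only [x, hp, if_false]
      field_simp
      ring
  choose e he using fun n => hX.pow hρ.le n
  -- Coefficients of `log κ + log (1 - X) = log κ - ∑ X ^ n / n`. Since `1 / 0 = 0`, the slot `n =
  -- 0` is free for `log κ`.
  let coefLog : ℕ → ℂ := fun n => (if n = 0 then (Real.log κ : ℂ) else 0) - 1 / n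
  have hcoef : ∀ n, ‖coefLog n‖ ≤ |Real.log κ| + 1 := by
    intro n
    refine (norm_sub_le _ _).trans (add_le_add ?_ ?_)
    · split_ifs
      · rw [Complex.norm_real]; rfl
      · simp
    · rw [norm_div, norm_one, Complex.norm_natCast]
      rcases Nat.eq_zero_or_pos n with rfl | hn
      · simp
      · rw [div_le_one (by positivity)]
        exact_mod_cast hn
  have hgeom : Summable fun n : ℕ => (1 / 2 : ℝ) ^ n := summable_geometric_two
  have hlog := HasBidiskSum.tsum hρ.le (fun n => ((he n).const_mul (coefLog n)).mono
    (mul_le_mul_of_nonneg_right (hcoef n) (by positivity))) (hgeom.mul_left _)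
  have hinv := HasBidiskSum.tsum hρ.le (fun n => (he n).const_mul (κ : ℂ)⁻¹) (hgeom.mul_left _)
  refine ⟨ρ, hρ, hρρ₀, _, _, _, K, _, _, hlog.mono (le_max_left _ _), hinv.mono (le_max_right _ _),
    fun z w hz hw => ⟨hKc z w hz hw, ?_, ?_, ?_⟩⟩
  · have hlt : ‖X z w‖ < 1 := (hXnorm z w hz hw).trans_lt (by norm_num)
    have hne : 1 - X z w ≠ 0 := by
      intro h
      rw [← sub_eq_zero.1 h] at hlt
      simp at hlt
    rw [tsum_mul_left, tsum_geometric_of_norm_lt_one hlt]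
    simp only [K]
    field_simp
  · simpa [K, hκ'] using hXnorm z w hz hw
  · have hlt : ‖X z w‖ < 1 := (hXnorm z w hz hw).trans_lt (by norm_num)
    have h1 : K z w / κ = 1 - X z w := by simp [K, hκ']
    have h2 := (hasSum_ite_eq (0 : ℕ) (Real.log κ : ℂ)).sub (Complex.hasSum_taylorSeries_neg_log hlt)
    rw [h1, ← sub_neg_eq_add, ← h2.tsum_eq]
    refine tsum_congr fun n => ?_
    rcases eq_or_ne n 0 with rfl | hn
    · simp [coefLog]
    · simp [coefLog, hn]
      ring

/-- If `K z w` is a double power series with `K 0 0 > 0` and `K z 0 = conj (K 0 (conj z))`, then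
there is a function `a` holomorphic in two variables such that `exp (2 * (a t z).re) = ‖K z (conj z)‖`
whenever `‖z‖ ^ 2 * K z (conj z) = t`. -/
theorem exists_modulus_factor {ρ₀ κ : ℝ} (hρ₀ : 0 < ρ₀) (hκ : 0 < κ) {c : ℕ × ℕ → ℂ}
    (hc : Summable fun p : ℕ × ℕ => ‖c p‖ * ρ₀ ^ (p.1 + p.2)) (hc0 : c 0 = κ)
    (hsymm : ∀ r, c (r, 0) = conj (c (0, r))) :
    ∃ r : ℝ, 0 < r ∧ r ≤ ρ₀ ∧ ∃ (D : ℝ) (d : ℕ × ℕ → ℂ) (a : ℂ → ℂ → ℂ), HasBidiskSum r D d a ∧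
      (∀ t : ℝ, |t| ≤ r → (a t 0).im = 0) ∧
      (∀ (t : ℝ) (z k : ℂ), |t| ≤ r → ‖z‖ ≤ r →
        HasSum (fun p : ℕ × ℕ => c p * (z ^ p.1 * conj z ^ p.2)) k →
        z * conj z * k = t → Real.exp (2 * (a t z).re) = ‖k‖) ∧
      ∀ z : ℂ, ‖z‖ ≤ r →
        HasSum (fun n => c (n, 0) / ((Real.sqrt κ : ℝ) : ℂ) * z ^ n) (Complex.exp (a 0 z)) := by
  obtain ⟨ρ, hρ, hρρ₀, C, l, g, K, L, G, hL, hG, hK⟩ := exists_reciprocal_and_log hρ₀ hκ hc hc0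
  obtain ⟨r, hr, hrρ, D, d, a, ha, hre, hmod, hzero⟩ :=
    exists_two_mul_re_eq (K := K) hρ hL hG fun z w hz hw => (hK z w hz hw).2.1
  have hκ' : (κ : ℂ) ≠ 0 := by exact_mod_cast hκ.ne'
  have hKne : ∀ z w : ℂ, ‖z‖ ≤ ρ → ‖w‖ ≤ ρ → K z w ≠ 0 := fun z w hz hw h => by
    simpa [h] using (hK z w hz hw).2.1
  have hexp : ∀ z w : ℂ, ‖z‖ ≤ ρ → ‖w‖ ≤ ρ → Complex.exp (L z w) = K z w := by
    intro z w hz hw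
    rw [(hK z w hz hw).2.2.2, Complex.exp_add, Complex.exp_log (div_ne_zero (hKne z w hz hw) hκ'),
      ← Complex.ofReal_exp, Real.exp_log hκ]
    field_simp
  have h0 : ‖(0 : ℂ)‖ ≤ ρ := by simpa using hρ.le
  have hKb : HasBidiskSum ρ _ c K :=
    (HasBidiskSum.anti (.of_summable hc) hρ.le hρρ₀).congr fun z w hz hw =>
      ((hK z w hz hw).1.tsum_eq)
  have hK00 : K 0 0 = κ := by rw [hKb.apply_zero_zero hρ.le, hc0]
  have hKsymm : ∀ z : ℂ, ‖z‖ ≤ ρ → K z 0 = conj (K 0 (conj z)) := by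
    intro z hz
    refine (hKb.hasSum_fst hz).unique ?_
    refine (Complex.hasSum_conj'.2 (hKb.hasSum_snd (w := conj z) (by simpa using hz))).congr_forall
      fun n => ?_
    simp [hsymm]
  have hL00 : L 0 0 = Real.log κ := by
    rw [(hK 0 0 h0 h0).2.2.2, hK00, div_self hκ', Complex.log_one, add_zero]
  have hLsymm : ∀ z : ℂ, ‖z‖ ≤ ρ → L z 0 = conj (L 0 (conj z)) := by
    intro z hz
    have hz' : ‖conj z‖ ≤ ρ := by simpa using hz
    rw [(hK z 0 hz h0).2.2.2, (hK 0 _ h0 hz').2.2.2, map_add, Complex.conj_ofReal, hKsymm z hz]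
    -- A positive real part keeps the argument off the branch cut, where `log` fails to commute with
    -- conjugation.
    have hre : 0 < (K 0 (conj z) / κ).re := by
      have h1 := (Complex.abs_re_le_norm _).trans (hK 0 _ h0 hz').2.2.1
      rw [Complex.sub_re, Complex.one_re, abs_le] at h1
      linarith [h1.1]
    rw [← Complex.log_conj _ (Complex.mem_slitPlane_iff_arg.1 (Or.inl hre)).1, map_div₀,
      Complex.conj_ofReal]
  refine ⟨r, hr, hrρ.trans hρρ₀, D, d, a, ha, hre, fun t z k ht hz hk hzt => ?_, fun z hz => ?_⟩
  · have hzρ := hz.trans hrρ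
    have hz' : ‖conj z‖ ≤ ρ := by simpa using hzρ
    obtain rfl := hk.unique (hK z (conj z) hzρ hz').1
    rw [hmod t z ht hz hzt, ← Complex.norm_exp, hexp z _ hzρ hz']
  · have hzρ := hz.trans hrρ
    -- By symmetry the two axis terms coincide, so `a 0 z = L z 0 - log κ / 2`.
    have h1 : Complex.exp (a 0 z) = K z 0 / (Real.sqrt κ : ℝ) := by
      rw [hzero z hz, ← hLsymm z hzρ, hL00, Complex.conj_ofReal, ← hexp z 0 hzρ h0,
        Real.sqrt_eq_rpow, Real.rpow_def_of_pos hκ, Complex.ofReal_exp, ← Complex.exp_sub]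
      congr 1
      push_cast
      ring
    rw [h1]
    exact ((hKb.hasSum_fst hzρ).div_const _).congr_forall fun n => by ring

/-! ### Topology of the level domains -/

section LevelDomain

variable {U : Set ℂ} {μ : ℂ → ℝ} {ε : ℝ}

theorem isOpen_sublevel (hU : IsOpen U) (hμ : ContinuousOn μ U) :
    IsOpen {z : ℂ | z ∈ U ∧ μ z < ε ^ 2} :=
  hμ.isOpen_inter_preimage hU isOpen_Iio

theorem isOpen_levelDomain (hU : IsOpen U) (hμ : ContinuousOn μ U) :
    IsOpen (levelDomain U μ ε) :=
  (isOpen_sublevel hU hμ).connectedComponentIn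

theorem zero_mem_levelDomain (h0U : (0 : ℂ) ∈ U) (hμ0 : μ 0 = 0) (hε : 0 < ε) :
    (0 : ℂ) ∈ levelDomain U μ ε :=
  mem_connectedComponentIn ⟨h0U, by rw [hμ0]; positivity⟩

/-- A frontier point with `μ z > ε²` would have a neighbourhood free of the domain. One with `μ z <
ε²` could be added to the component without losing connectedness, so it would already lie in this
open set. -/
theorem eq_sq_of_mem_frontier_levelDomain (hU : IsOpen U) (hμ : ContinuousOn μ U) {z : ℂ}
    (hzU : z ∈ U) (hz : z ∈ frontier (levelDomain U μ ε)) : μ z = ε ^ 2 := by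
  have hopen : IsOpen (levelDomain U μ ε) := isOpen_levelDomain hU hμ
  rw [hopen.frontier_eq] at hz
  have hsub : levelDomain U μ ε ⊆ {z : ℂ | z ∈ U ∧ μ z < ε ^ 2} := connectedComponentIn_subset _ _
  apply le_antisymm
  · by_contra! hlt
    have h1 : ∀ᶠ y in 𝓝 z, ε ^ 2 < μ y :=
      ((hμ z hzU).continuousAt (hU.mem_nhds hzU)).eventually (lt_mem_nhds hlt)
    obtain ⟨y, hy, hyE⟩ := mem_closure_iff_nhds.1 hz.1 _ h1
    exact absurd (hsub hyE).2 (not_lt.2 (le_of_lt hy))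
  · by_contra! hlt
    have hne : (levelDomain U μ ε).Nonempty := closure_nonempty_iff.1 ⟨z, hz.1⟩
    refine hz.2 ?_
    obtain ⟨y, hy⟩ := hne
    have hins : IsPreconnected (insert z (levelDomain U μ ε)) :=
      isPreconnected_connectedComponentIn.subset_closure (Set.subset_insert _ _)
        (Set.insert_subset hz.1 subset_closure)
    have h2 := hins.subset_connectedComponentIn (Set.mem_insert_of_mem z hy)
      (Set.insert_subset (show z ∈ {z : ℂ | z ∈ U ∧ μ z < ε ^ 2} from ⟨hzU, hlt⟩) hsub)
    have h3 : connectedComponentIn {z : ℂ | z ∈ U ∧ μ z < ε ^ 2} y = levelDomain U μ ε :=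
      (connectedComponentIn_eq hy).symm
    exact h3 ▸ h2 (Set.mem_insert _ _)

/-- The component is connected, contains `0` when nonempty, and cannot cross the sphere. -/
theorem levelDomain_subset_ball {s : ℝ} (hs : 0 < s)
    (h : ∀ z ∈ Metric.sphere (0 : ℂ) s, ε ^ 2 ≤ μ z) :
    levelDomain U μ ε ⊆ Metric.ball 0 s := by
  by_cases h0 : (0 : ℂ) ∈ {z : ℂ | z ∈ U ∧ μ z < ε ^ 2}
  · have hpre : IsPreconnected (levelDomain U μ ε) := isPreconnected_connectedComponentIn
    refine hpre.subset_left_of_subset_union Metric.isOpen_ball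
      (Metric.isClosed_closedBall (x := (0 : ℂ)) (ε := s)).isOpen_compl ?_ ?_
      ⟨0, mem_connectedComponentIn h0, Metric.mem_ball_self hs⟩
    · exact Set.disjoint_left.2 fun x hx hx' => hx' (Metric.ball_subset_closedBall hx)
    · intro z hz
      by_contra hcon
      rw [Set.mem_union, not_or, Set.mem_compl_iff, not_not] at hcon
      have hzs : z ∈ Metric.sphere (0 : ℂ) s :=
        le_antisymm (Metric.mem_closedBall.1 hcon.2) (not_lt.1 hcon.1)
      exact absurd ((connectedComponentIn_subset _ _) hz).2 (not_lt.2 (h z hzs))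
  · rw [levelDomain, connectedComponentIn_eq_empty h0]
    exact Set.empty_subset _

end LevelDomain

/-! ### Univalent maps onto a disk: surjectivity, uniqueness, radius of univalence -/

/-- The maximum principle puts the image inside the disk. The image is open, and it is relatively
closed in the disk because the compact set `f '' closure E` adds only points of modulus `ε`;
connectedness of the disk finishes. -/
theorem bijOn_ball_of_norm_eq_on_frontier {E V : Set ℂ} {f : ℂ → ℂ} {ε : ℝ} (hε : 0 < ε)
    (hE : IsOpen E) (hEc : IsPreconnected E) (hEb : Bornology.IsBounded E) (h0 : (0 : ℂ) ∈ E)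
    (hEV : closure E ⊆ V) (hf : DifferentiableOn ℂ f V)
    (hinj : Set.InjOn f V) (hf0 : f 0 = 0) (hfr : ∀ z ∈ frontier E, ‖f z‖ = ε) :
    Set.BijOn f E (Metric.ball 0 ε) := by
  have hfE : DifferentiableOn ℂ f E := hf.mono (subset_closure.trans hEV)
  have hcl : DiffContOnCl ℂ f E := ⟨hfE, hf.continuousOn.mono hEV⟩
  have hle : ∀ z ∈ E, ‖f z‖ ≤ ε := fun z hz =>
    Complex.norm_le_of_forall_mem_frontier_norm_le hEb hcl (fun w hw => (hfr w hw).le)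
      (subset_closure hz)
  have hmaps : Set.MapsTo f E (Metric.ball 0 ε) := by
    intro z hz
    rw [mem_ball_zero_iff]
    refine lt_of_le_of_ne (hle z hz) fun heq => ?_
    have hmax : IsMaxOn (norm ∘ f) E z := fun w hw => by
      simpa [heq] using hle w hw
    have := Complex.eqOn_of_isPreconnected_of_isMaxOn_norm hEc hE hfE hz hmax h0
    rw [hf0, Function.const_apply] at this
    rw [← this, norm_zero] at heq
    exact hε.ne heq
  have hopen : IsOpen (f '' E) := by
    rcases (hfE.analyticOnNhd hE).is_constant_or_isOpen hEc with ⟨w, hw⟩ | h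
    -- A constant map is excluded by injectivity, as `E` contains a second point on the real axis.
    · exfalso
      have hsub : E.Subsingleton := fun x hx y hy =>
        hinj (hEV (subset_closure hx)) (hEV (subset_closure hy)) ((hw x hx).trans (hw y hy).symm)
      obtain ⟨y, hy0, hyE⟩ := (Metric.nhds_basis_ball.mem_iff.1 (hE.mem_nhds h0))
      have : ((y / 2 : ℝ) : ℂ) ∈ E := hyE (by
        rw [mem_ball_zero_iff, Complex.norm_real, Real.norm_of_nonneg (by positivity)]
        linarith)
      have h2 := hsub this h0
      rw [Complex.ofReal_eq_zero] at h2
      linarith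
    · exact h E subset_rfl hE
  refine ⟨hmaps, hinj.mono (subset_closure.trans hEV), ?_⟩
  refine (convex_ball (0 : ℂ) ε).isPreconnected.subset_of_closure_inter_subset hopen
    ⟨0, Metric.mem_ball_self hε, 0, h0, hf0⟩ ?_
  rintro w ⟨hw, hwε⟩
  have hcomp : IsCompact (f '' closure E) :=
    hEb.isCompact_closure.image_of_continuousOn (hf.continuousOn.mono hEV)
  obtain ⟨z, hz, rfl⟩ := closure_minimal (Set.image_mono subset_closure) hcomp.isClosed hw
  refine ⟨z, ?_, rfl⟩
  by_contra hzE
  have := hfr z (by rw [hE.frontier_eq]; exact ⟨hz, hzE⟩)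
  rw [mem_ball_zero_iff, this] at hwε
  exact lt_irrefl _ hwε

/-- The open mapping theorem makes `g` continuous, and `g` is differentiable at images of points
where `deriv f` is nonzero. Zeros of `deriv f` are isolated, since `f` is nowhere locally constant,
so any remaining singularity of `g` is removable. -/
theorem differentiableOn_leftInverse_of_injOn {E : Set ℂ} {f g : ℂ → ℂ} (hE : IsOpen E)
    (hf : DifferentiableOn ℂ f E) (hinj : Set.InjOn f E) (hg : Set.LeftInvOn g f E) :
    DifferentiableOn ℂ g (f '' E) := by
  have han := hf.analyticOnNhd hE
  have hnotconst : ∀ z ∈ E, ∀ c, ¬ ∀ᶠ w in 𝓝 z, f w = c := by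
    intro z hz c hc
    have h1 : ∀ᶠ w in 𝓝[≠] z, f w = c ∧ w ∈ E ∧ w ≠ z := by
      filter_upwards [hc.filter_mono nhdsWithin_le_nhds,
        (hE.mem_nhds hz : E ∈ 𝓝 z) |> mem_nhdsWithin_of_mem_nhds, self_mem_nhdsWithin]
        with w h1 h2 h3 using ⟨h1, h2, h3⟩
    obtain ⟨w, hw1, hw2, hw3⟩ := h1.exists
    exact hw3 (hinj hw2 hz (hw1.trans hc.self_of_nhds.symm))
  have hmap : ∀ z ∈ E, 𝓝 (f z) ≤ map f (𝓝 z) := fun z hz =>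
    (han z hz).eventually_constant_or_nhds_le_map_nhds.resolve_left (hnotconst z hz _)
  have hcont : ∀ z ∈ E, ContinuousAt g (f z) := by
    intro z hz
    rw [ContinuousAt, hg hz]
    intro N hN
    have h1 : f '' (N ∩ E) ∈ 𝓝 (f z) := hmap z hz (image_mem_map (inter_mem hN (hE.mem_nhds hz)))
    refine mem_map.2 (mem_of_superset h1 ?_)
    rintro _ ⟨w, ⟨hwN, hwE⟩, rfl⟩
    simpa only [Set.mem_preimage, hg hwE] using hwN
  have himage : ∀ z ∈ E, f '' E ∈ 𝓝 (f z) := fun z hz =>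
    hmap z hz (image_mem_map (hE.mem_nhds hz))
  have hright : ∀ w ∈ f '' E, f (g w) = w := by
    rintro _ ⟨z, hz, rfl⟩
    rw [hg hz]
  have hreg : ∀ z ∈ E, deriv f z ≠ 0 → DifferentiableAt ℂ g (f z) := by
    intro z hz hd
    have h1 : HasDerivAt f (deriv f z) (g (f z)) := by
      rw [hg hz]
      exact (han z hz).differentiableAt.hasDerivAt
    exact (HasDerivAt.of_local_left_inverse (hcont z hz) h1 hd
      (mem_of_superset (himage z hz) hright)).differentiableAt
  rintro _ ⟨z, hz, rfl⟩
  refine DifferentiableAt.differentiableWithinAt (AnalyticAt.differentiableAt (𝕜 := ℂ) ?_)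
  refine Complex.analyticAt_of_differentiable_on_punctured_nhds_of_continuousAt ?_ (hcont z hz)
  have hd : ∀ᶠ w in 𝓝[≠] z, deriv f w ≠ 0 := by
    refine ((han z hz).deriv.eventually_eq_zero_or_eventually_ne_zero).resolve_left fun h => ?_
    obtain ⟨r, hr, hrs⟩ := Metric.eventually_nhds_iff_ball.1 (h.and (hE.mem_nhds hz))
    refine hnotconst z hz (f z) (Metric.eventually_nhds_iff_ball.2 ⟨r, hr, fun w hw => ?_⟩)
    exact (convex_ball z r).is_const_of_fderivWithin_eq_zero (𝕜 := ℂ)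
      (hf.mono fun x hx => (hrs x hx).2)
      (fun x hx => by
        rw [fderivWithin_of_isOpen Metric.isOpen_ball hx, ← toSpanSingleton_deriv, (hrs x hx).1]
        simp) hw (Metric.mem_ball_self hr)
  have htend : Tendsto g (𝓝[≠] (f z)) (𝓝[≠] z) := by
    refine tendsto_nhdsWithin_iff.2 ⟨?_, ?_⟩
    · have := (hcont z hz).tendsto
      rw [hg hz] at this
      exact this.mono_left nhdsWithin_le_nhds
    · filter_upwards [mem_nhdsWithin_of_mem_nhds (himage z hz), self_mem_nhdsWithin] with w hw hne heq
      exact hne (by rw [← hright w hw, Set.mem_singleton_iff.1 heq]; rfl)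
  filter_upwards [htend.eventually hd, mem_nhdsWithin_of_mem_nhds (himage z hz)] with w hw hwE
  obtain ⟨x, hx, rfl⟩ := hwE
  rw [hg hx] at hw
  exact hreg x hx hw

namespace IsNormalizedRiemannMap

variable {E : Set ℂ} {ε : ℝ} {f g : ℂ → ℂ}

/-- Schwarz lemma for `f ∘ g⁻¹`, a self-map of the disk fixing `0`. -/
theorem norm_le_norm (hE : IsOpen E) (h0 : (0 : ℂ) ∈ E) (hf : IsNormalizedRiemannMap E ε f)
    (hg : IsNormalizedRiemannMap E ε g) {z : ℂ} (hz : z ∈ E) : ‖f z‖ ≤ ‖g z‖ := by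
  have hleft := hg.bijOn.injOn.leftInvOn_invFunOn
  have hinv := differentiableOn_leftInverse_of_injOn hE hg.holo hg.bijOn.injOn hleft
  rw [hg.bijOn.image_eq] at hinv
  have hmaps : Set.MapsTo (Function.invFunOn g E) (Metric.ball 0 ε) E := by
    have := hg.bijOn.surjOn.mapsTo_invFunOn
    exact this
  have h := Complex.norm_le_norm_of_mapsTo_ball (hf.holo.comp hinv hmaps)
    ((hf.bijOn.mapsTo.comp hmaps).mono_right Metric.ball_subset_closedBall)
    (by
      have : Function.invFunOn g E 0 = 0 := by simpa [hg.map_zero] using hleft h0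
      simp [this, hf.map_zero])
    (mem_ball_zero_iff.1 (hg.bijOn.mapsTo hz))
  rwa [Function.comp_apply, hleft hz] at h

/-- The normalized Riemann mapping is unique. -/
theorem eqOn (hε : 0 < ε) (hE : IsOpen E) (h0 : (0 : ℂ) ∈ E) (hf : IsNormalizedRiemannMap E ε f)
    (hg : IsNormalizedRiemannMap E ε g) : Set.EqOn f g E := by
  have hnorm : ∀ z ∈ E, ‖f z‖ = ‖g z‖ := fun z hz =>
    le_antisymm (norm_le_norm hE h0 hf hg hz) (norm_le_norm hE h0 hg hf hz)
  have hleft := hg.bijOn.injOn.leftInvOn_invFunOn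
  have hinv := differentiableOn_leftInverse_of_injOn hE hg.holo hg.bijOn.injOn hleft
  rw [hg.bijOn.image_eq] at hinv
  have hmaps : Set.MapsTo (Function.invFunOn g E) (Metric.ball 0 ε) E :=
    hg.bijOn.surjOn.mapsTo_invFunOn
  set ψ : ℂ → ℂ := f ∘ Function.invFunOn g E
  have hψ : ∀ z ∈ E, ψ (g z) = f z := fun z hz => by
    simp only [ψ, Function.comp_apply, hleft hz]
  have hψ0 : ψ 0 = 0 := by
    have := hψ 0 h0
    rwa [hg.map_zero, hf.map_zero] at this
  have hψd : DifferentiableOn ℂ ψ (Metric.ball 0 ε) := hf.holo.comp hinv hmaps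
  have hψm : Set.MapsTo ψ (Metric.ball 0 ε) (Metric.closedBall (ψ 0) ε) := by
    rw [hψ0]
    exact (hf.bijOn.mapsTo.comp hmaps).mono_right Metric.ball_subset_closedBall
  have hw₀ : ((ε / 2 : ℝ) : ℂ) ∈ Metric.ball (0 : ℂ) ε := by
    rw [mem_ball_zero_iff, Complex.norm_real, Real.norm_of_nonneg (by positivity)]
    linarith
  have hw₀0 : ((ε / 2 : ℝ) : ℂ) ≠ 0 := by
    rw [Complex.ofReal_ne_zero]
    positivity
  -- Equality in the Schwarz lemma at the single point `ε / 2` already forces `ψ` to be a rotation;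
  -- positivity of both derivatives then makes it the identity.
  obtain ⟨C, hC, hCψ⟩ := Complex.affine_of_mapsTo_ball_of_exists_norm_dslope_eq_div' hψd hψm
    ⟨_, hw₀, by
      obtain ⟨z, hz, hzw⟩ := hg.bijOn.surjOn hw₀
      rw [dslope_of_ne _ hw₀0, slope_def_module, hψ0, sub_zero, sub_zero, norm_smul, norm_inv,
        ← hzw, hψ z hz, hnorm z hz, div_self hε.ne']
      refine inv_mul_cancel₀ ?_
      rw [hzw]
      exact norm_ne_zero_iff.2 hw₀0⟩
  rw [div_self hε.ne'] at hC
  have hfC : ∀ z ∈ E, f z = C * g z := by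
    intro z hz
    have := hCψ (hg.bijOn.mapsTo hz)
    simp only [hψ z hz, hψ0, zero_add, sub_zero, smul_eq_mul] at this
    rw [this, mul_comm]
  have hderiv : deriv f 0 = C * deriv g 0 := by
    have hev : f =ᶠ[𝓝 0] fun z => C * g z := eventually_of_mem (hE.mem_nhds h0) hfC
    rw [hev.deriv_eq]
    exact deriv_const_mul _ ((hg.holo 0 h0).differentiableAt (hE.mem_nhds h0))
  have hfr : deriv f 0 = ((deriv f 0).re : ℂ) := by
    apply Complex.ext <;> simp [hf.deriv_im]
  have hgr : deriv g 0 = ((deriv g 0).re : ℂ) := by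
    apply Complex.ext <;> simp [hg.deriv_im]
  rw [hfr, hgr] at hderiv
  have hn := congrArg norm hderiv
  rw [norm_mul, hC, one_mul, Complex.norm_real, Complex.norm_real,
    Real.norm_of_nonneg hf.deriv_re_pos.le, Real.norm_of_nonneg hg.deriv_re_pos.le] at hn
  have hgne : ((deriv g 0).re : ℂ) ≠ 0 := Complex.ofReal_ne_zero.2 hg.deriv_re_pos.ne'
  rw [hn] at hderiv
  have hC1 : C = 1 := (mul_eq_right₀ hgne).1 hderiv.symm
  intro z hz
  rw [hfC z hz, hC1, one_mul]

end IsNormalizedRiemannMap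

/-- A quantitative inverse function theorem: the radius of univalence is bounded below in terms of
a bound for the function and a lower bound for its derivative at the centre. -/
theorem exists_injOn_ball {R M m : ℝ} (hR : 0 < R) (hM : 0 < M) (hm : 0 < m) :
    ∃ s : ℝ, 0 < s ∧ s ≤ R ∧ ∀ g : ℂ → ℂ, DifferentiableOn ℂ g (Metric.ball 0 R) →
      (∀ z ∈ Metric.ball (0 : ℂ) R, ‖g z‖ ≤ M) → m ≤ ‖deriv g 0‖ →
      Set.InjOn g (Metric.ball 0 s) := by
  -- Cauchy's estimate gives `‖deriv g‖ ≤ 2 * M / R` on the half disk, and the Schwarz lemma for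
  -- `deriv g` gives `‖deriv g z - deriv g 0‖ ≤ 8 * M / R ^ 2 * ‖z‖`. The second entry makes this at
  -- most `m / 2`.
  let s : ℝ := min (R / 2) (m * R ^ 2 / (16 * M))
  have hs : 0 < s := by positivity
  have hsR : s ≤ R / 2 := min_le_left _ _
  have hsm : 8 * M / R ^ 2 * s ≤ m / 2 := by
    have h1 : s ≤ m * R ^ 2 / (16 * M) := min_le_right _ _
    calc 8 * M / R ^ 2 * s ≤ 8 * M / R ^ 2 * (m * R ^ 2 / (16 * M)) := by gcongr
      _ = m / 2 := by field_simp; norm_num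
  refine ⟨s, hs, hsR.trans (by linarith), fun g hg hgM hgm => ?_⟩
  have hd : ∀ z ∈ Metric.ball (0 : ℂ) (R / 2), ‖deriv g z‖ ≤ M / (R / 2) := by
    intro z hz
    have hsub : Metric.closedBall z (R / 2) ⊆ Metric.ball 0 R := by
      intro w hw
      have h1 := dist_triangle w z 0
      rw [Metric.mem_ball] at hz ⊢
      rw [Metric.mem_closedBall] at hw
      linarith
    refine Complex.norm_deriv_le_of_forall_mem_sphere_norm_le (by positivity) ?_ fun w hw =>
      hgM w (hsub (Metric.sphere_subset_closedBall hw))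
    exact (hg.mono (by rwa [closure_ball _ (by positivity)])).diffContOnCl
  have hd2 : DifferentiableOn ℂ (deriv g) (Metric.ball 0 (R / 2)) :=
    (hg.deriv Metric.isOpen_ball).mono (Metric.ball_subset_ball (by linarith))
  have hlip : ∀ z ∈ Metric.ball (0 : ℂ) s, ‖deriv g z - deriv g 0‖ ≤ m / 2 := by
    intro z hz
    have hz2 : z ∈ Metric.ball (0 : ℂ) (R / 2) := Metric.ball_subset_ball hsR hz
    have h1 := Complex.dist_le_div_mul_dist_of_mapsTo_ball (R₂ := 2 * (M / (R / 2))) hd2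
      (fun w hw => by
        rw [Metric.mem_closedBall, dist_eq_norm]
        refine (norm_sub_le _ _).trans ?_
        linarith [hd w hw, hd 0 (Metric.mem_ball_self (by positivity))]) hz2
    rw [dist_eq_norm] at h1
    refine h1.trans (le_trans ?_ hsm)
    calc 2 * (M / (R / 2)) / (R / 2) * dist z 0 = 8 * M / R ^ 2 * dist z 0 := by
          field_simp
          norm_num [mul_comm]
      _ ≤ 8 * M / R ^ 2 * s := by
          gcongr
          exact (Metric.mem_ball.1 hz).le
  intro x hx y hy hxy
  -- `g` differs from `deriv g 0 * z` by an `m / 2`-Lipschitz function, too little to cancel a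
  -- linear part of slope at least `m`.
  have hmv := (convex_ball (0 : ℂ) s).norm_image_sub_le_of_norm_hasDerivWithin_le
    (f := fun z => g z - deriv g 0 * z) (f' := fun z => deriv g z - deriv g 0) (C := m / 2)
    (fun z hz => by
      have hzR : z ∈ Metric.ball (0 : ℂ) R := Metric.ball_subset_ball (by linarith) hz
      have h1 := ((hg z hzR).differentiableAt (Metric.isOpen_ball.mem_nhds hzR)).hasDerivAt
      have h2 := (hasDerivAt_id z).const_mul (deriv g 0)
      rw [mul_one] at h2
      exact (h1.sub h2).hasDerivWithinAt) hlip hx hy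
  have h3 : g y - deriv g 0 * y - (g x - deriv g 0 * x) = -(deriv g 0 * (y - x)) := by
    rw [hxy]; ring
  rw [h3, norm_neg, norm_mul] at hmv
  by_contra hne
  have hpos : 0 < ‖y - x‖ := norm_pos_iff.2 (sub_ne_zero.2 (Ne.symm hne))
  nlinarith

/-! ### Expansions in `z` and `conj z`: uniqueness and existence -/

theorem eq_zero_of_hasSum_real_pow {b : ℕ → ℂ}
    (h : ∀ᶠ t : ℝ in 𝓝 0, HasSum (fun n => (t : ℂ) ^ n * b n) 0) : ∀ n, b n = 0 := by
  let p : FormalMultilinearSeries ℝ ℝ ℂ := fun n => ContinuousMultilinearMap.mkPiRing ℝ (Fin n) (b n)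
  have hp : ∀ n, p.coeff n = b n := fun n => by
    simp [p, FormalMultilinearSeries.coeff]
  have hs : HasFPowerSeriesAt (fun _ : ℝ => (0 : ℂ)) p 0 := by
    rw [hasFPowerSeriesAt_iff]
    filter_upwards [h] with t ht
    refine ht.congr_forall fun n => ?_
    rw [hp, Complex.real_smul, Complex.ofReal_pow]
  intro n
  rw [← hp, hs.eq_zero, FormalMultilinearSeries.coeff]
  rfl

/-- Uniqueness of the expansion in powers of `z` and `conj z`. -/
theorem eq_zero_of_hasSum_pow_mul_conj_pow {d : ℕ × ℕ → ℂ}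
    (h : ∀ᶠ z in 𝓝 (0 : ℂ),
      HasSum (fun p : ℕ × ℕ => d p * z ^ (p.1 + 1) * conj z ^ (p.2 + 1)) 0) : d = 0 := by
  have hP : ∀ u : ℂ, ‖u‖ = 1 → ∀ n,
      ∑ p ∈ Finset.HasAntidiagonal.antidiagonal n, d p * u ^ (p.1 + 1) * conj u ^ (p.2 + 1) = 0 := by
    intro u _ n
    -- Along the ray `t * u` the monomials are graded by total degree `p.1 + p.2 + 2`, so the
    -- homogeneous part of index `n` is the coefficient of `t ^ (n + 2)`.
    let b : ℕ → ℂ := fun m => if m < 2 then 0 else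
      ∑ p ∈ Finset.HasAntidiagonal.antidiagonal (m - 2), d p * u ^ (p.1 + 1) * conj u ^ (p.2 + 1)
    have hb : b (n + 2) = 0 := by
      refine eq_zero_of_hasSum_real_pow ?_ _
      have htend : Tendsto (fun t : ℝ => (t : ℂ) * u) (𝓝 0) (𝓝 0) := by
        have : Continuous fun t : ℝ => (t : ℂ) * u := by fun_prop
        simpa using this.tendsto 0
      filter_upwards [htend.eventually h] with t ht
      rw [← Finset.HasAntidiagonal.sigmaAntidiagonalEquivProd.hasSum_iff] at ht
      have h1 := ht.sigma fun m => hasSum_fintype _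
      rw [← hasSum_nat_add_iff' 2]
      simp only [Finset.sum_range_succ, Finset.sum_range_zero, b]
      norm_num
      refine h1.congr_forall fun m => ?_
      rw [Finset.mul_sum, ← Finset.sum_coe_sort]
      refine Finset.sum_congr rfl fun x _ => ?_
      have hx : x.1.1 + x.1.2 = m := Finset.HasAntidiagonal.mem_antidiagonal.1 x.2
      simp only [Function.comp_apply, Finset.HasAntidiagonal.sigmaAntidiagonalEquivProd_apply, map_mul,
        Complex.conj_ofReal, mul_pow, ← hx]
      ring
    simpa [b] using hb
  ext ⟨r, s⟩
  -- On the unit circle `conj u = u⁻¹`, so multiplying the homogeneous part by `u ^ (r + s)` gives a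
  -- polynomial in `u` with infinitely many zeros. Its exponents `2 * p.1` are distinct on the
  -- antidiagonal, so each coefficient can be read off.
  let Q : Polynomial ℂ := ∑ p ∈ Finset.HasAntidiagonal.antidiagonal (r + s),
    Polynomial.monomial (2 * p.1) (d p)
  have hQ : Q = 0 := by
    refine Polynomial.eq_zero_of_infinite_isRoot Q (Set.Infinite.mono ?_ (?_ :
      (Metric.sphere (0 : ℂ) 1).Infinite))
    · intro u hu
      rw [mem_sphere_zero_iff_norm] at hu
      have huu : u * conj u = 1 := by
        rw [Complex.mul_conj, Complex.normSq_eq_norm_sq, hu]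
        norm_num
      have h1 := congrArg (u ^ (r + s) * ·) (hP u hu (r + s))
      simp only [mul_zero, Finset.mul_sum] at h1
      rw [Set.mem_ofPred_eq, Polynomial.IsRoot.def, Polynomial.eval_finsetSum, ← h1]
      refine Finset.sum_congr rfl fun p hp => ?_
      rw [← Finset.HasAntidiagonal.mem_antidiagonal.1 hp, Polynomial.eval_monomial]
      calc d p * u ^ (2 * p.1) = d p * u ^ (2 * p.1) * (u * conj u) ^ (p.2 + 1) := by
            rw [huu, one_pow, mul_one]
        _ = _ := by ring
    · refine (isPreconnected_sphere (by simp [Complex.rank_real_complex]) 0 1).infinite_of_nontrivial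
        ⟨1, by simp, -1, by simp, by norm_num⟩
  have hcoeff := congrArg (fun q => Polynomial.coeff q (2 * r)) hQ
  simp only [Q, Polynomial.finsetSum_coeff, Polynomial.coeff_monomial, Polynomial.coeff_zero]
    at hcoeff
  rw [Finset.sum_eq_single (r, s)] at hcoeff
  · simpa using hcoeff
  · rintro ⟨r', s'⟩ hp hne
    rw [if_neg]
    intro heq
    have := Finset.HasAntidiagonal.mem_antidiagonal.1 hp
    refine hne (Prod.ext ?_ ?_) <;> simp at this heq ⊢ <;> omega
  · intro hp
    exact absurd (Finset.HasAntidiagonal.mem_antidiagonal.2 (rfl : (r, s).1 + (r, s).2 = r + s)) hp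

/-- `μ` is real, so conjugating its expansion gives a second one; uniqueness identifies them. -/
theorem IsTaylorExpansion.conj_symm {μ : ℂ → ℝ} {c : ℕ → ℕ → ℂ} (hc : IsTaylorExpansion μ c)
    (r s : ℕ) : c r s = conj (c s r) := by
  have h : (fun p : ℕ × ℕ => c p.1 p.2 - conj (c p.2 p.1)) = 0 := by
    refine eq_zero_of_hasSum_pow_mul_conj_pow ?_
    filter_upwards [hc] with z hz
    have h1 := Complex.hasSum_conj'.2 hz
    rw [Complex.conj_ofReal, ← (Equiv.prodComm ℕ ℕ).hasSum_iff] at h1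
    have h2 := hz.sub h1
    rw [sub_self] at h2
    refine h2.congr_forall fun p => ?_
    simp
    ring
  exact sub_eq_zero.1 (congrFun h (r, s))

/-- A homogeneous real polynomial form on `ℂ` as a polynomial in `z` and `conj z`. -/
theorem exists_coeff_multilinear {n : ℕ} (p : ContinuousMultilinearMap ℝ (fun _ : Fin n => ℂ) ℝ) :
    ∃ q : Finset (Fin n) → ℂ, (∀ s, ‖q s‖ ≤ ‖p‖) ∧
      ∀ z : ℂ, (p (fun _ => z) : ℂ) = ∑ s, q s * (z ^ s.card * conj z ^ sᶜ.card) := by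
  let b : Fin 2 → ℂ := ![1, Complex.I]
  let α : Fin 2 → ℂ := ![1 / 2, 1 / (2 * Complex.I)]
  let β : Fin 2 → ℂ := ![1 / 2, -1 / (2 * Complex.I)]
  let x : ℂ → Fin 2 → ℝ := fun z => ![z.re, z.im]
  have hb : ∀ j, ‖b j‖ = 1 := by intro j; fin_cases j <;> simp [b]
  have hα : ∀ j, ‖α j‖ = 1 / 2 := by intro j; fin_cases j <;> simp [α]
  have hβ : ∀ j, ‖β j‖ = 1 / 2 := by intro j; fin_cases j <;> simp [β]
  have hx : ∀ z j, (x z j : ℂ) = α j * z + β j * conj z := by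
    intro z j
    have h1 := Complex.re_eq_add_conj z
    have h2 := Complex.im_eq_sub_conj z
    fin_cases j
    · simp only [x, α, β, Fin.zero_eta, Matrix.cons_val_zero, h1]
      ring
    · simp only [x, α, β, Fin.mk_one, Matrix.cons_val_one, Matrix.cons_val_zero, h2]
      field_simp
      ring
  have hz : ∀ z, z = ∑ j, x z j • b j := by
    intro z
    simp [x, b, Complex.re_add_im]
  refine ⟨fun s => ∑ v : Fin n → Fin 2, ((∏ i ∈ s, α (v i)) * ∏ i ∈ sᶜ, β (v i)) *
    (p (fun i => b (v i)) : ℂ), fun s => ?_, fun z => ?_⟩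
  · refine (norm_sum_le _ _).trans ?_
    -- There are `2 ^ n` index vectors, and each carries the factor `(1 / 2) ^ n` from `α` and `β`,
    -- so no exponential constant is lost.
    have hterm : ∀ v : Fin n → Fin 2, ‖((∏ i ∈ s, α (v i)) * ∏ i ∈ sᶜ, β (v i)) *
        (p (fun i => b (v i)) : ℂ)‖ ≤ (1 / 2) ^ n * ‖p‖ := by
      intro v
      have h1 : ‖p (fun i => b (v i))‖ ≤ ‖p‖ := by
        simpa [hb] using p.le_opNorm (fun i => b (v i))
      rw [norm_mul, norm_mul, norm_prod, norm_prod, Complex.norm_real]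
      simp only [hα, hβ, Finset.prod_const]
      rw [← pow_add, Finset.card_add_card_compl, Fintype.card_fin]
      gcongr
    refine (Finset.sum_le_sum fun v _ => hterm v).trans (le_of_eq ?_)
    rw [Finset.sum_const, Finset.card_univ, Fintype.card_fun, Fintype.card_fin, Fintype.card_fin,
      nsmul_eq_mul, ← mul_assoc]
    push_cast
    rw [← mul_pow]
    norm_num
  · have h1 : p (fun _ => z) = ∑ v : Fin n → Fin 2, (∏ i, x z (v i)) * p (fun i => b (v i)) := by
      conv_lhs => rw [hz z]
      rw [p.map_sum]
      refine Finset.sum_congr rfl fun v _ => ?_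
      rw [p.map_smul_univ, smul_eq_mul]
    rw [h1]
    push_cast
    simp only [hx, Finset.prod_add, Finset.powerset_univ, Finset.sum_mul]
    rw [Finset.sum_comm]
    refine Finset.sum_congr rfl fun s _ => Finset.sum_congr rfl fun v _ => ?_
    rw [Finset.prod_mul_distrib, Finset.prod_mul_distrib, Finset.prod_const, Finset.prod_const,
      ← Finset.compl_eq_univ_sdiff]
    ring

/-- A real analytic function has an absolutely convergent expansion in `z` and `conj z`. -/
theorem exists_hasSum_pow_mul_conj_pow {k : ℂ → ℝ} (hk : AnalyticAt ℝ k 0) :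
    ∃ c : ℕ × ℕ → ℂ, ∀ᶠ z in 𝓝 (0 : ℂ),
      HasSum (fun p : ℕ × ℕ => c p * (z ^ p.1 * conj z ^ p.2)) (k z : ℂ) := by
  obtain ⟨p, R, hp⟩ := hk
  obtain ⟨ρ, hρ0, hρ⟩ := ENNReal.lt_iff_exists_nnreal_btwn.1 hp.r_pos
  have hρ0' : (0 : ℝ) < ρ := by exact_mod_cast hρ0
  have hsum := p.summable_norm_mul_pow (hρ.trans_le hp.r_le)
  choose q hq hqz using fun n => exists_coeff_multilinear (p n)
  let σ : (Σ n, Finset (Fin n)) → ℕ × ℕ := fun x => (x.2.card, x.2ᶜ.card)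
  refine ⟨fun a => ∑' x : σ ⁻¹' {a}, q x.1.1 x.1.2, ?_⟩
  -- The `2 ^ n` subsets of `Fin n` in degree `n` are paid for by halving the radius.
  filter_upwards [Metric.ball_mem_nhds (0 : ℂ) (half_pos hρ0')] with z hz
  rw [mem_ball_zero_iff] at hz
  let T : (Σ n, Finset (Fin n)) → ℂ := fun x => q x.1 x.2 * (z ^ x.2.card * conj z ^ x.2ᶜ.card)
  have hTle : ∀ n (s : Finset (Fin n)), ‖T ⟨n, s⟩‖ ≤ ‖p n‖ * ((ρ : ℝ) / 2) ^ n := by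
    intro n s
    simp only [T]
    rw [norm_mul, norm_mul, norm_pow, norm_pow, RCLike.norm_conj, ← pow_add,
      Finset.card_add_card_compl, Fintype.card_fin]
    gcongr
    exact hq n s
  have hT : Summable T := by
    refine Summable.of_norm ((summable_sigma_of_nonneg fun _ => norm_nonneg _).2
      ⟨fun n => (hasSum_fintype _).summable, ?_⟩)
    refine Summable.of_nonneg_of_le (fun n => tsum_nonneg fun _ => norm_nonneg _) (fun n => ?_) hsum
    rw [tsum_fintype]
    refine (Finset.sum_le_sum fun s _ => hTle n s).trans (le_of_eq ?_)
    rw [Finset.sum_const, Finset.card_univ, Fintype.card_finset, Fintype.card_fin, nsmul_eq_mul,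
      div_pow]
    push_cast
    field_simp
  have h1 := hT.hasSum.sigma fun n => hasSum_fintype _
  have hzball : z ∈ Metric.eball (0 : ℂ) R := by
    refine Metric.eball_subset_eball hρ.le ?_
    rw [Metric.eball_coe, mem_ball_zero_iff]
    linarith
  have h2 := Complex.ofRealCLM.hasSum (hp.hasSum hzball)
  have h3 : ∑' x, T x = k z := by
    refine h1.unique ?_
    rw [zero_add] at h2
    refine h2.congr_forall fun n => ?_
    rw [Complex.ofRealCLM_apply, hqz]
  rw [← h3]
  refine (hT.hasSum.tsum_fiberwise σ).congr_forall fun a => ?_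
  rw [← tsum_mul_right]
  refine tsum_congr ?_
  rintro ⟨x, rfl⟩
  rfl

theorem exists_isTaylorExpansion {U : Set ℂ} (hU : IsOpen U) (h0U : (0 : ℂ) ∈ U) {k μ : ℂ → ℝ}
    (hk : AnalyticAt ℝ k 0) (hμ : ∀ z ∈ U, μ z = k z * ‖z‖ ^ 2) :
    ∃ c : ℕ → ℕ → ℂ, IsTaylorExpansion μ c := by
  obtain ⟨c, hc⟩ := exists_hasSum_pow_mul_conj_pow hk
  refine ⟨fun r s => c (r, s), ?_⟩
  filter_upwards [hc, hU.mem_nhds h0U] with z hz hzU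
  rw [hμ z hzU]
  have h1 := hz.mul_right (z * conj z)
  have h2 : ((k z * ‖z‖ ^ 2 : ℝ) : ℂ) = k z * (z * conj z) := by
    rw [Complex.mul_conj, Complex.normSq_eq_norm_sq]
    push_cast
    rfl
  rw [h2]
  exact h1.congr_forall fun p => by ring

/-- The coefficients of an expansion of `k z * ‖z‖ ^ 2` give an expansion of `k`. -/
theorem IsTaylorExpansion.exists_radius {U : Set ℂ} (hU : IsOpen U) (h0U : (0 : ℂ) ∈ U)
    {k μ : ℂ → ℝ} (hk : ContinuousAt k 0) (hμ : ∀ z ∈ U, μ z = k z * ‖z‖ ^ 2)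
    {c : ℕ → ℕ → ℂ} (hc : IsTaylorExpansion μ c) :
    c 0 0 = k 0 ∧ ∃ ρ : ℝ, 0 < ρ ∧
      (Summable fun p : ℕ × ℕ => ‖c p.1 p.2‖ * ρ ^ (p.1 + p.2)) ∧
      ∀ z : ℂ, ‖z‖ ≤ ρ →
        HasSum (fun p : ℕ × ℕ => c p.1 p.2 * (z ^ p.1 * conj z ^ p.2)) (k z : ℂ) := by
  obtain ⟨ρ, hρ, hball⟩ := Metric.eventually_nhds_iff_ball.1 (hc.and (hU.mem_nhds h0U))
  have hρ2 : 0 < ρ / 2 := half_pos hρ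
  have hmem : ∀ z : ℂ, ‖z‖ ≤ ρ / 2 → z ∈ Metric.ball (0 : ℂ) ρ := fun z hz => by
    rw [mem_ball_zero_iff]
    linarith
  -- Absolute convergence at the single real point `ρ / 2` is already the weighted summability.
  have hsum : Summable fun p : ℕ × ℕ => ‖c p.1 p.2‖ * (ρ / 2) ^ (p.1 + p.2) := by
    have hn : ‖((ρ / 2 : ℝ) : ℂ)‖ = ρ / 2 := by
      rw [Complex.norm_real, Real.norm_of_nonneg hρ2.le]
    have h1 := (hball _ (hmem ((ρ / 2 : ℝ) : ℂ) hn.le)).1.summable.norm.mul_right ((ρ / 2) ^ 2)⁻¹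
    refine h1.congr fun p => ?_
    rw [norm_mul, norm_mul, norm_pow, norm_pow, RCLike.norm_conj, hn]
    field_simp
    ring
  have hne : ∀ z : ℂ, ‖z‖ ≤ ρ / 2 → z ≠ 0 →
      HasSum (fun p : ℕ × ℕ => c p.1 p.2 * (z ^ p.1 * conj z ^ p.2)) (k z : ℂ) := by
    intro z hz hz0
    obtain ⟨h1, h2⟩ := hball z (hmem z hz)
    have hzz : z * conj z ≠ 0 := mul_ne_zero hz0 (by simpa using hz0)
    have h3 : (μ z : ℂ) = k z * (z * conj z) := by
      rw [hμ z h2, Complex.mul_conj, Complex.normSq_eq_norm_sq]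
      push_cast
      rfl
    rw [h3] at h1
    have h4 := h1.mul_right (z * conj z)⁻¹
    rw [mul_inv_cancel_right₀ hzz] at h4
    refine h4.congr_forall fun p => ?_
    rw [eq_mul_inv_iff_mul_eq₀ hzz]
    ring
  have hK := HasBidiskSum.of_summable (f := fun p : ℕ × ℕ => c p.1 p.2) hsum
  -- Division by `z * conj z` recovers `k` only away from `0`; the value at `0` follows by
  -- continuity of both sides.
  have hc0 : c 0 0 = k 0 := by
    have hmem0 : ((0 : ℂ), (0 : ℂ)) ∈ Metric.ball (0 : ℂ) (ρ / 2) ×ˢ Metric.ball (0 : ℂ) (ρ / 2) :=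
      ⟨Metric.mem_ball_self hρ2, Metric.mem_ball_self hρ2⟩
    have hcont := hK.differentiableOn.continuousOn.continuousAt
      ((Metric.isOpen_ball.prod Metric.isOpen_ball).mem_nhds hmem0)
    have hconj : Tendsto (fun z : ℂ => (z, conj z)) (𝓝 0) (𝓝 (0, 0)) := by
      have : Continuous fun z : ℂ => (z, conj z) := by fun_prop
      simpa using this.tendsto 0
    have h1 := hcont.tendsto.comp hconj
    have h2 : Tendsto (fun z => (k z : ℂ)) (𝓝 0) (𝓝 (k 0)) :=
      (Complex.continuous_ofReal.tendsto _).comp hk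
    have h00 := hK.apply_zero_zero hρ2.le
    refine (h00.symm.trans (tendsto_nhds_unique_of_frequently_eq h1 h2 ?_) : _)
    have hev : ∀ᶠ z in 𝓝[≠] (0 : ℂ), z ≠ 0 ∧ ‖z‖ ≤ ρ / 2 := by
      filter_upwards [self_mem_nhdsWithin,
        mem_nhdsWithin_of_mem_nhds (Metric.closedBall_mem_nhds (0 : ℂ) hρ2)] with z h1 h2
      exact ⟨h1, mem_closedBall_zero_iff.1 h2⟩
    refine (hev.frequently.filter_mono nhdsWithin_le_nhds).mono fun z hz => ?_
    exact (hne z hz.2 hz.1).tsum_eq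
  refine ⟨hc0, ρ / 2, hρ2, hsum, fun z hz => ?_⟩
  rcases eq_or_ne z 0 with rfl | hz0
  · have h00 := hK.hasSum 0 (conj 0) hz (by simpa using hz)
    rw [map_zero] at h00 ⊢
    rw [hK.apply_zero_zero hρ2.le] at h00
    rw [← hc0]
    exact h00
  · exact hne z hz hz0

/-! ### Construction of a Riemann mapping family -/

theorem exists_pos_le_on_sphere {U : Set ℂ} {μ : ℂ → ℝ} (hμ : ContinuousOn μ U) {s : ℝ}
    (hs : 0 < s) (hsU : Metric.sphere (0 : ℂ) s ⊆ U)
    (hpos : ∀ z ∈ Metric.sphere (0 : ℂ) s, 0 < μ z) :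
    ∃ δ : ℝ, 0 < δ ∧ ∀ z ∈ Metric.sphere (0 : ℂ) s, δ ≤ μ z := by
  obtain ⟨z, hz, hmin⟩ := (isCompact_sphere (0 : ℂ) s).exists_isMinOn
    (NormedSpace.sphere_nonempty.2 hs.le) (hμ.mono hsU)
  exact ⟨μ z, hpos z hz, fun w hw => hmin hw⟩

theorem exists_isRiemannFamily {U : Set ℂ} (hU : IsOpen U) (h0U : (0 : ℂ) ∈ U)
    {k μ : ℂ → ℝ} (hk : ContinuousOn k U) (hkpos : ∀ z ∈ U, 0 < k z)
    (hμ : ∀ z ∈ U, μ z = k z * ‖z‖ ^ 2) {c : ℕ → ℕ → ℂ} (hc : IsTaylorExpansion μ c) :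
    ∃ (R₁ R₂ : ℝ) (h : ℂ → ℂ → ℂ), IsRiemannFamily U μ R₁ R₂ h ∧
      (∀ ε z : ℂ, h (-ε) z = h ε z) ∧ ∃ s : ℝ, 0 < s ∧ ∀ z : ℂ, ‖z‖ < s →
        HasSum (fun r : ℕ => c r 0 / ((Real.sqrt (k 0) : ℝ) : ℂ) * z ^ (r + 1)) (h 0 z) := by
  obtain ⟨hc0, ρ₀, hρ₀, hsum, hKk⟩ := hc.exists_radius hU h0U
    ((hk 0 h0U).continuousAt (hU.mem_nhds h0U)) hμ
  obtain ⟨r, hr, hrρ₀, D, d, a, ha, hare, hamod, ha0⟩ := exists_modulus_factor hρ₀ (hkpos 0 h0U)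
    (c := fun p => c p.1 p.2) hsum hc0 (fun n => hc.conj_symm n 0)
  obtain ⟨ρ₁, hρ₁, hρ₁U⟩ := Metric.isOpen_iff.1 hU 0 h0U
  have hμc : ContinuousOn μ U := by
    have : ContinuousOn (fun z => k z * ‖z‖ ^ 2) U := hk.mul (by fun_prop)
    exact this.congr hμ
  have hμ0 : μ 0 = 0 := by simp [hμ 0 h0U]
  let R : ℝ := min r ρ₁
  have hR : 0 < R := lt_min hr hρ₁
  have hRr : R ≤ r := min_le_left _ _
  have hRρ₁ : R ≤ ρ₁ := min_le_right _ _
  -- From `|Re a| ≤ D` come `‖h ε z‖ ≤ R * exp D` and `‖deriv (h ε) 0‖ ≥ exp (-D)`, uniformly in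
  -- `ε`; hence one radius of univalence serves all small `ε`.
  obtain ⟨s, hs, hsR, hinj⟩ := exists_injOn_ball hR (M := R * Real.exp D) (m := Real.exp (-D))
    (by positivity) (by positivity)
  have hs2 : 0 < s / 2 := half_pos hs
  have hsU : Metric.closedBall (0 : ℂ) (s / 2) ⊆ U :=
    (Metric.closedBall_subset_ball (by linarith)).trans hρ₁U
  obtain ⟨δ, hδ, hδμ⟩ := exists_pos_le_on_sphere hμc hs2
    (Metric.sphere_subset_closedBall.trans hsU) fun z hz => by
      have hzU := hsU (Metric.sphere_subset_closedBall hz)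
      rw [hμ z hzU, mem_sphere_zero_iff_norm.1 hz]
      exact mul_pos (hkpos z hzU) (by positivity)
  -- For `x < 1`, `x ^ 2 ≤ x`: then `ε ^ 2 < r` keeps the parameter in the domain of `a`, and `ε ^ 2
  -- < δ` confines the level domain to the ball of radius `s / 2`.
  let R₁ : ℝ := min 1 (min r δ)
  have hR₁ : 0 < R₁ := lt_min one_pos (lt_min hr hδ)
  have hsq : ∀ x : ℝ, 0 ≤ x → x < R₁ → x ^ 2 < r ∧ x ^ 2 < δ := by
    intro x hx0 hx
    have h1 : x < 1 := hx.trans_le (min_le_left _ _)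
    have h2 : x < min r δ := hx.trans_le (min_le_right _ _)
    have h3 : x ^ 2 < min r δ := lt_of_le_of_lt (by nlinarith) h2
    exact lt_min_iff.1 h3
  let h : ℂ → ℂ → ℂ := fun ε z => z * Complex.exp (a (ε ^ 2) z)
  have hslice : ∀ τ : ℂ, ‖τ‖ < r → DifferentiableOn ℂ (a τ) (Metric.ball 0 R) := by
    intro τ hτ
    refine ha.differentiableOn.comp (t := Metric.ball 0 r ×ˢ Metric.ball 0 r)
      (f := fun z => (τ, z)) (by fun_prop) fun z hz => ?_
    exact ⟨mem_ball_zero_iff.2 hτ, Metric.ball_subset_ball hRr hz⟩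
  have hderiv : ∀ ε : ℂ, ‖ε ^ 2‖ < r → deriv (h ε) 0 = Complex.exp (a (ε ^ 2) 0) := by
    intro ε hε
    have h1 := ((hslice _ hε 0 (Metric.mem_ball_self hR)).differentiableAt
      (Metric.ball_mem_nhds _ hR)).hasDerivAt.cexp
    have h2 : HasDerivAt (h ε) _ 0 := (hasDerivAt_id (0 : ℂ)).mul h1
    simpa using h2.deriv
  have hbound : ∀ τ z : ℂ, ‖τ‖ ≤ r → ‖z‖ ≤ r → |(a τ z).re| ≤ D := fun τ z hτ hz =>
    (Complex.abs_re_le_norm _).trans (ha.norm_le hτ hz)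
  have h0r : ‖(0 : ℂ)‖ ≤ r := by simpa using hr.le
  have hball : ∀ z ∈ Metric.ball (0 : ℂ) R, ‖z‖ ≤ r := fun z hz =>
    (mem_ball_zero_iff.1 hz).le.trans hRr
  have hhd : ∀ ε : ℂ, ‖ε ^ 2‖ < r → DifferentiableOn ℂ (h ε) (Metric.ball 0 R) := fun ε hε =>
    differentiableOn_id.mul (hslice _ hε).cexp
  have hhinj : ∀ ε : ℂ, ‖ε ^ 2‖ < r → Set.InjOn (h ε) (Metric.ball 0 s) := by
    intro ε hε
    refine hinj _ (hhd ε hε) (fun z hz => ?_) ?_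
    · rw [norm_mul, Complex.norm_exp]
      gcongr
      · exact (mem_ball_zero_iff.1 hz).le
      · exact (le_abs_self _).trans (hbound _ _ hε.le (hball z hz))
    · rw [hderiv ε hε, Complex.norm_exp]
      gcongr
      exact (abs_le.1 (hbound _ _ hε.le h0r)).1
  have hsub : ∀ ε : ℝ, 0 < ε → ε < R₁ → levelDomain U μ ε ⊆ Metric.ball 0 (s / 2) :=
    fun ε hε hεR => levelDomain_subset_ball hs2 fun z hz =>
      (hsq ε hε.le hεR).2.le.trans (hδμ z hz)
  refine ⟨R₁, s, h, ⟨hR₁, hs, ?_, fun ε hε hεR => (hsub ε hε hεR).trans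
    (Metric.ball_subset_ball (by linarith)), fun ε hε hεR => ?_⟩, fun ε z => by simp [h],
    s, hs, fun z hz => ?_⟩
  · refine differentiableOn_snd.mul (DifferentiableOn.cexp ?_)
    refine ha.differentiableOn.comp (t := Metric.ball 0 r ×ˢ Metric.ball 0 r)
      (f := fun p : ℂ × ℂ => (p.1 ^ 2, p.2)) (by fun_prop) ?_
    rintro ⟨ε, z⟩ ⟨hε, hz⟩
    refine ⟨?_, Metric.ball_subset_ball (hsR.trans hRr) hz⟩
    rw [mem_ball_zero_iff, norm_pow]
    exact (hsq _ (norm_nonneg _) (mem_ball_zero_iff.1 hε)).1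
  · have hε2 : ‖(ε : ℂ) ^ 2‖ < r := by
      rw [norm_pow, Complex.norm_real, Real.norm_of_nonneg hε.le]
      exact (hsq ε hε.le hεR).1
    have hE : IsOpen (levelDomain U μ ε) := isOpen_levelDomain hU hμc
    have hcl : closure (levelDomain U μ ε) ⊆ Metric.closedBall 0 (s / 2) :=
      closure_minimal ((hsub ε hε hεR).trans Metric.ball_subset_closedBall) Metric.isClosed_closedBall
    have hcls : closure (levelDomain U μ ε) ⊆ Metric.ball 0 s :=
      hcl.trans (Metric.closedBall_subset_ball (by linarith))
    have hd := (hhd ε hε2).mono (Metric.ball_subset_ball hsR)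
    have hexp : deriv (h ε) 0 = (Real.exp (a ((ε : ℂ) ^ 2) 0).re : ℂ) := by
      have h1 : (a ((ε : ℂ) ^ 2) 0).im = 0 := by
        have := hare (ε ^ 2) (by rw [abs_of_nonneg (by positivity)]; exact (hsq ε hε.le hεR).1.le)
        rwa [Complex.ofReal_pow] at this
      rw [hderiv _ hε2, Complex.ofReal_exp]
      congr 1
      apply Complex.ext <;> simp [h1]
    refine ⟨hd.mono (subset_closure.trans hcls), ?_, by simp [h], ?_, ?_⟩
    · refine bijOn_ball_of_norm_eq_on_frontier hε hE isPreconnected_connectedComponentIn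
        (Metric.isBounded_ball.subset (hsub ε hε hεR)) (zero_mem_levelDomain h0U hμ0 hε) hcls hd
        (hhinj ε hε2) (by simp [h]) fun z hz => ?_
      have hzc := hcl (frontier_subset_closure hz)
      have hzU := hsU hzc
      have hzr : ‖z‖ ≤ r := by
        have := mem_closedBall_zero_iff.1 hzc
        linarith
      have hμz := eq_sq_of_mem_frontier_levelDomain hU hμc hzU hz
      rw [hμ z hzU] at hμz
      -- On the frontier `‖z‖ ^ 2 * k z = ε ^ 2`, so `‖h ε z‖ ^ 2 = ‖z‖ ^ 2 * exp (2 * Re a) = ‖z‖ ^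
      -- 2 * k z = ε ^ 2`.
      have hmod := hamod (ε ^ 2) z (k z)
        (by rw [abs_of_nonneg (by positivity)]; exact (hsq ε hε.le hεR).1.le) hzr
        (hKk z (hzr.trans hrρ₀))
        (by
          rw [← hμz, Complex.mul_conj, Complex.normSq_eq_norm_sq]
          push_cast
          ring)
      rw [Complex.norm_real, Real.norm_of_nonneg (hkpos z hzU).le, Complex.ofReal_pow] at hmod
      refine (sq_eq_sq₀ (norm_nonneg _) hε.le).1 ?_
      rw [norm_mul, Complex.norm_exp, mul_pow, ← Real.exp_nat_mul, Nat.cast_two, hmod, mul_comm, hμz]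
    · rw [hexp, Complex.ofReal_re]
      positivity
    · rw [hexp, Complex.ofReal_im]
  · have hzr : ‖z‖ ≤ r := hz.le.trans (hsR.trans hRr)
    have h1 := (ha0 z hzr).mul_left z
    simp only [h]
    rw [zero_pow two_ne_zero]
    exact h1.congr_forall fun n => by ring

/-! ### Uniqueness of the limit and convergence on the full disk -/

/-- Two Riemann mapping families have the same limit at `ε = 0`. -/
theorem IsRiemannFamily.eq_at_zero {U : Set ℂ} (hU : IsOpen U) (h0U : (0 : ℂ) ∈ U) {μ : ℂ → ℝ}
    (hμ : ContinuousOn μ U) (hμ0 : μ 0 = 0) {R₁ R₂ R₁' R₂' : ℝ} {h h' : ℂ → ℂ → ℂ}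
    (hh : IsRiemannFamily U μ R₁ R₂ h) (hh' : IsRiemannFamily U μ R₁' R₂' h') {z : ℂ}
    (hz : ‖z‖ < min R₂ R₂') : h 0 z = h' 0 z := by
  have hR := lt_min hh.pos₂ hh'.pos₂
  have hslice : ∀ {R₁ R₂ : ℝ} {h : ℂ → ℂ → ℂ}, IsRiemannFamily U μ R₁ R₂ h → ∀ ε : ℂ, ‖ε‖ < R₁ →
      DifferentiableOn ℂ (h ε) (Metric.ball 0 R₂) := by
    intro R₁ R₂ h hh ε hε
    refine hh.holo.comp (t := Metric.ball 0 R₁ ×ˢ Metric.ball 0 R₂) (f := fun z => (ε, z))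
      (by fun_prop) fun z hz => ⟨mem_ball_zero_iff.2 hε, hz⟩
  have hcont : ∀ {R₁ R₂ : ℝ} {h : ℂ → ℂ → ℂ}, IsRiemannFamily U μ R₁ R₂ h → ‖z‖ < R₂ →
      Tendsto (fun ε : ℝ => h ε z) (𝓝[>] 0) (𝓝 (h 0 z)) := by
    intro R₁ R₂ h hh hz
    have hmem : ((0 : ℂ), z) ∈ Metric.ball (0 : ℂ) R₁ ×ˢ Metric.ball (0 : ℂ) R₂ :=
      ⟨Metric.mem_ball_self hh.pos₁, mem_ball_zero_iff.2 hz⟩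
    have h1 := hh.holo.continuousOn.continuousAt
      ((Metric.isOpen_ball.prod Metric.isOpen_ball).mem_nhds hmem)
    have h2 : Tendsto (fun ε : ℝ => ((ε : ℂ), z)) (𝓝 0) (𝓝 (0, z)) := by
      have : Continuous fun ε : ℝ => ((ε : ℂ), z) := by fun_prop
      simpa using this.tendsto 0
    exact (h1.tendsto.comp h2).mono_left nhdsWithin_le_nhds
  -- For `ε > 0` the two maps agree on the level domain, which may not contain `z`; the identity
  -- theorem extends this to the common disk, and then `ε → 0+`.
  refine tendsto_nhds_unique_of_eventuallyEq (hcont hh (hz.trans_le (min_le_left _ _)))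
    (hcont hh' (hz.trans_le (min_le_right _ _))) ?_
  filter_upwards [Ioo_mem_nhdsGT (lt_min hh.pos₁ hh'.pos₁)] with ε hε
  have hε₁ : ε < R₁ := hε.2.trans_le (min_le_left _ _)
  have hε₂ : ε < R₁' := hε.2.trans_le (min_le_right _ _)
  have hεn : ‖(ε : ℂ)‖ = ε := by rw [Complex.norm_real, Real.norm_of_nonneg hε.1.le]
  have hE : IsOpen (levelDomain U μ ε) := isOpen_levelDomain hU hμ
  have h0E := zero_mem_levelDomain h0U hμ0 hε.1
  have heq := (hh.riemann ε hε.1 hε₁).eqOn hε.1 hE h0E (hh'.riemann ε hε.1 hε₂)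
  have han := ((hslice hh ε (by rwa [hεn])).mono
    (Metric.ball_subset_ball (min_le_left R₂ R₂'))).analyticOnNhd Metric.isOpen_ball
  have han' := ((hslice hh' ε (by rwa [hεn])).mono
    (Metric.ball_subset_ball (min_le_right R₂ R₂'))).analyticOnNhd Metric.isOpen_ball
  exact han.eqOn_of_preconnected_of_eventuallyEq han' (convex_ball _ _).isPreconnected
    (Metric.mem_ball_self hR) (eventually_of_mem (hE.mem_nhds h0E) heq) (mem_ball_zero_iff.2 hz)

/-- A power series representing a holomorphic function near `0` represents it on every disk on
which the function is holomorphic. -/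
theorem hasSum_on_ball_of_eventually {f : ℂ → ℂ} {R : ℝ}
    (hf : DifferentiableOn ℂ f (Metric.ball 0 R)) (hR : 0 < R) {b : ℕ → ℂ}
    (h : ∀ᶠ z in 𝓝 (0 : ℂ), HasSum (fun n => b n * z ^ (n + 1)) (f z))
    {z : ℂ} (hz : ‖z‖ < R) : HasSum (fun n => b n * z ^ (n + 1)) (f z) := by
  let b' : ℕ → ℂ := fun n => if n = 0 then 0 else b (n - 1)
  let t : ℕ → ℂ := fun n => ((n.factorial : ℂ))⁻¹ * iteratedDeriv n f 0
  have ht : ∀ w : ℂ, ‖w‖ < R → HasSum (fun n => t n * w ^ n) (f w) := by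
    intro w hw
    refine (Complex.hasSum_taylorSeries_on_ball (r := R) hf
      (mem_ball_zero_iff.2 hw)).congr_forall fun n => ?_
    simp only [t, sub_zero, smul_eq_mul]
    ring
  have hshift : ∀ w : ℂ, HasSum (fun n => b' n * w ^ n) (f w) ↔
      HasSum (fun n => b n * w ^ (n + 1)) (f w) := by
    intro w
    rw [← hasSum_nat_add_iff' 1]
    simp [b']
  -- The two series agree at small real arguments, which suffices to identify their coefficients.
  have hbt : ∀ n, b' n - t n = 0 := by
    refine eq_zero_of_hasSum_real_pow ?_
    have htend : Tendsto (fun x : ℝ => (x : ℂ)) (𝓝 0) (𝓝 0) := by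
      simpa using Complex.continuous_ofReal.tendsto 0
    filter_upwards [htend.eventually h, htend.eventually (Metric.ball_mem_nhds (0 : ℂ) hR)]
      with x hx hxR
    have h1 := ((hshift x).2 hx).sub (ht x (mem_ball_zero_iff.1 hxR))
    rw [sub_self] at h1
    exact h1.congr_forall fun n => by ring
  rw [← hshift]
  exact (ht z hz).congr_forall fun n => by rw [sub_eq_zero.1 (hbt n)]

end AsymptoticRiemann

theorem theorem4p2 (U : Set ℂ) (hU : IsOpen U) (h0U : (0 : ℂ) ∈ U)
    (k μ : ℂ → ℝ) (hk : AnalyticOnNhd ℝ k U) (hkpos : ∀ z ∈ U, 0 < k z)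
    (hμ : ∀ z ∈ U, μ z = k z * ‖z‖ ^ 2) :
    (∃ (R₁ R₂ : ℝ) (h : ℂ → ℂ → ℂ), AsymptoticRiemann.IsRiemannFamily U μ R₁ R₂ h ∧
      ∀ ε z : ℂ, ‖ε‖ < R₁ → ‖z‖ < R₂ → h (-ε) z = h ε z) ∧
    (∃ c : ℕ → ℕ → ℂ, AsymptoticRiemann.IsTaylorExpansion μ c) ∧
    ∀ (c : ℕ → ℕ → ℂ), AsymptoticRiemann.IsTaylorExpansion μ c →
      (0 < (c 0 0).re ∧ (c 0 0).im = 0) ∧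
      ∀ (R₁ R₂ : ℝ) (h : ℂ → ℂ → ℂ), AsymptoticRiemann.IsRiemannFamily U μ R₁ R₂ h →
        ∀ z : ℂ, ‖z‖ < R₂ →
          HasSum (fun r : ℕ => c r 0 / ((Real.sqrt (c 0 0).re : ℝ) : ℂ) * z ^ (r + 1)) (h 0 z) := by
  have hkc : ContinuousOn k U := hk.continuousOn
  have hμc : ContinuousOn μ U := by
    have : ContinuousOn (fun z => k z * ‖z‖ ^ 2) U := hkc.mul (by fun_prop)
    exact this.congr hμ
  have hμ0 : μ 0 = 0 := by simp [hμ 0 h0U]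
  obtain ⟨c₀, hc₀⟩ := AsymptoticRiemann.exists_isTaylorExpansion hU h0U (hk 0 h0U) hμ
  refine ⟨?_, ⟨c₀, hc₀⟩, fun c hc => ?_⟩
  · obtain ⟨R₁, R₂, h, hh, heven, -⟩ :=
      AsymptoticRiemann.exists_isRiemannFamily hU h0U hkc hkpos hμ hc₀
    exact ⟨R₁, R₂, h, hh, fun ε z _ _ => heven ε z⟩
  · obtain ⟨hc00, -⟩ := hc.exists_radius hU h0U (hk 0 h0U).continuousAt hμ
    have hre : (c 0 0).re = k 0 := by rw [hc00, Complex.ofReal_re]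
    refine ⟨⟨hre ▸ hkpos 0 h0U, by rw [hc00, Complex.ofReal_im]⟩, fun R₁ R₂ h hh z hz => ?_⟩
    obtain ⟨R₁', R₂', h', hh', -, s, hs, hsum⟩ :=
      AsymptoticRiemann.exists_isRiemannFamily hU h0U hkc hkpos hμ hc
    rw [hre]
    have hd : DifferentiableOn ℂ (h 0) (Metric.ball 0 R₂) :=
      hh.holo.comp (t := Metric.ball 0 R₁ ×ˢ Metric.ball 0 R₂) (f := fun z => ((0 : ℂ), z))
        (by fun_prop) fun z hz => ⟨Metric.mem_ball_self hh.pos₁, hz⟩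
    -- The constructed family gives the series only on a small disk; holomorphy of `h 0` on the ball
    -- of radius `R₂` extends it.
    refine AsymptoticRiemann.hasSum_on_ball_of_eventually hd hh.pos₂ ?_ hz
    filter_upwards [Metric.ball_mem_nhds (0 : ℂ) (lt_min hs (lt_min hh.pos₂ hh'.pos₂))] with w hw
    have hw' := lt_min_iff.1 (mem_ball_zero_iff.1 hw)
    rw [hh.eq_at_zero hU h0U hμc hμ0 hh' hw'.2]
    exact hsum w hw'.1
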